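/- **Setting.** Let $S$ be a non-empty set with a $\sigma$-algebra $\Sigma$, and let $X$ be a convex subset of a real vector space. $\mathcal F$ is the set of acts, i.e. of $\Sigma$-measurable finite-valued maps $f:S\to X$; acts are mixed statewise and $x\in X$ is identified with the constant act. $\Delta$ is the set of finitely additive probabilities on $\Sigma$, with the weak* topology (the coarsest that makes $p\mapsto\int\varphi\,dp$ continuous for all real $\Sigma$-measurable simple functions $\varphi$); $\Delta^\sigma\subseteq\Delta$ is the subspace of countably additive ones, and $\mathcal K$ the collection of non-empty, compact, convex subsets of $\Delta^\sigma$. For each $Q\in\mathcal K$ let $\succsim^*_Q$ and $\succsim_Q$ be binary relations on $\mathcal F$; write $\succsim^*_q$ for $\succsim^*_{\{q\}}$. **Preferences.** A *preference* is a relation $\succsim$ on $\mathcal F$ that is reflexive, transitive, monotone ($f(s)\succsim g(s)$ for all $s$ implies $f\succsim g$), continuous (for all $f,g,h$ the sets $\{\alpha\in[0,1]:\alpha f+(1-\alpha)g\succsim h\}$ and $\{\alpha\in[0,1]: h\succsim\alpha f+(1-\alpha)g\}$ are closed) and non-trivial ($f\succ g$ for some $f,g$). It is *unbounded* if for all $x\succ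 y$ in $X$ there are $z,z'\in X$ with $\frac12z+\frac12y\succsim x$ and $y\succsim\frac12x+\frac12z'$. It is *rational* if it is complete and, for $x,y,z\in X$, $\alpha\in(0,1)$, $x\sim y$ implies $\alpha x+(1-\alpha)z\sim\alpha y+(1-\alpha)z$. A preference $\succsim^*_Q$ is a *dominance relation* if it is complete on $X$; complete on $\mathcal F$ when $Q$ is a singleton; weakly c-independent ($\alpha f+(1-\alpha)x\succsim^*_Q\alpha g+(1-\alpha)x$ implies $\alpha f+(1-\alpha)y\succsim^*_Q\alpha g+(1-\alpha)y$, for $f,g\in\mathcal F$, $x,y\in X$, $\alpha\in(0,1)$); and convex ($f\succsim^*_Q h$ and $g\succsim^*_Q h$ imply $\alpha f+(1-\alpha)g\succsim^*_Q h$ for $\alpha\in(0,1)$). **Robustness.** The family is *robust* if: 1. (monotonicity) $Q'\subseteq Q$ and $f\succsim^*_Q g$ imply $f\succsim^*_{Q'}g$; (separability) $f\succsim^*_q g$ for all $q\in Q$ implies $f\succsim^*_Q g$; (lower semicontinuity) for all $x\in X$, $f\in\mathcal F$ the set $\{q\in\Delta^\sigma: x\succsim^*_q x_{f,q}\}$ is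 closed in $\Delta^\sigma$, where $x_{f,q}\in X$ denotes a consequence with $f\sim^*_q x_{f,q}$; 2. for each $Q\in\mathcal K$, $\succsim^*_Q$ is an unbounded dominance relation, $\succsim_Q$ is a rational preference, and they satisfy: consistency ($f\succsim^*_Q g\Rightarrow f\succsim_Q g$); caution (for $x\in X$, $f\not\succsim^*_Q x\Rightarrow x\succsim_Q f$); objective $Q$-coherence (if $q(f=g)=1$ for all $q\in Q$ then $f\sim^*_Q g$); subjective $Q$-coherence: for each $p\in\Delta$, one has $p\in\overline{\mathrm{co}}\,Q$ (weak* closure of the convex hull, in $\Delta$) if and only if $x\succ^*_Q x^p_f\Rightarrow x\succ_Q f$ for all $f\in\mathcal F$, $x\in X$ and all $x^p_f\in X$ with $v(x_f^p)=\int v(f)\,dp$, where $v:X\to\mathbb R$ is an affine utility that represents $\succsim_Q$ on $X$. It is *model hybridization averse* (A.8) if, for all $q,q'\in\Delta^\sigma$, $\lambda\in(0,1)$, $f\in\mathcal F$ and all $Q\in\mathcal K$, $\lambda x_{f,q}+(1-\lambda)x_{f,q'}\succsim^*_Q x_{f,\lambda q+(1-\lambda)q'}$. **Divergences.** A function $k:\Delta\to[0,\infty]$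 is *grounded* if $\inf k=0$. A function $c:\Delta\times\Delta^\sigma\to[0,\infty]$ is a *variational divergence* if each section $c(\cdot,q)$ is grounded, lower semicontinuous and convex; $c(p,q)=0\iff p=q$; $c(p,q)<\infty$ only if $p\ll q$; and, for each $Q\in\mathcal K$, $c_Q(p)=\min_{q\in Q}c(p,q)$ is well defined (the minimum is attained), grounded, lower semicontinuous and convex in $p$. **Statement.** The following are equivalent: (i) the family $\{(\succsim^*_Q,\succsim_Q)\}_{Q\in\mathcal K}$ is robust and model hybridization averse; (ii) there exist an onto affine $u:X\to\mathbb R$ and a jointly lower semicontinuous and jointly convex variational divergence $c:\Delta\times\Delta^\sigma\to[0,\infty]$ such that, for each $Q\in\mathcal K$ and all $f,g\in\mathcal F$, $$f\succsim^*_Q g\iff \min_{p\in\Delta}\Big\{\int u(f)\,dp+c(p,q)\Big\}\ge\min_{p\in\Delta}\Big\{\int u(g)\,dp+c(p,q)\Big\}\quad\forall q\in Q$$ and $$f\succsim_Q g\iff \min_{p\in\Delta}\Big\{\int u(f)\,dp+\min_{q\in Q}c(p,q)\Big\}\ge\min_{p\in\Delta}\Big\{\int u(g)\,dp+\min_{q\in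 Q}c(p,q)\Big\},$$ all these minima being attained. Moreover, $u$ is cardinally unique (if $(u,c)$ is as in (ii), then $u'$ belongs to some pair $(u',c')$ as in (ii) if and only if $u'=au+b$ for some $a>0$, $b\in\mathbb R$) and, given $u$, $c$ is unique. -/

import Mathlib

open MeasureTheory Set Topology
open scoped ENNReal unitInterval

namespace Misspec

/-! ### Finitely additive probabilities -/

/-- The set `Δ` of finitely additive probabilities on the `σ`-algebra of `S`. -/
@[ext]
structure FinProb (S : Type*) [MeasurableSpace S] where
  /-- the probability of an event -/
  prob : {A : Set S // MeasurableSet A} → ℝ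
  prob_nonneg : ∀ A, 0 ≤ prob A
  prob_univ : prob ⟨Set.univ, MeasurableSet.univ⟩ = 1
  prob_union : ∀ A B : {A : Set S // MeasurableSet A}, Disjoint A.1 B.1 →
    prob ⟨A.1 ∪ B.1, A.2.union B.2⟩ = prob A + prob B

section Prob

variable {S : Type*} [MeasurableSpace S]

/-- The integral of a real simple function against a finitely additive probability. -/
noncomputable def FinProb.integral (p : FinProb S) (φ : SimpleFunc S ℝ) : ℝ :=
  ∑ t ∈ φ.range, t * p.prob ⟨φ ⁻¹' {t}, φ.measurableSet_fiber t⟩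

/-- The weak* topology on `Δ`: the coarsest one that makes `p ↦ ∫ φ dp` continuous for every
simple function `φ`. -/
noncomputable instance FinProb.instTopologicalSpace : TopologicalSpace (FinProb S) :=
  TopologicalSpace.induced (fun p (φ : SimpleFunc S ℝ) => p.integral φ) inferInstance

/-- The mixture `α p + (1 - α) q`. -/
noncomputable def FinProb.mix (α : I) (p q : FinProb S) : FinProb S where
  prob A := (α : ℝ) * p.prob A + (1 - (α : ℝ)) * q.prob A
  prob_nonneg A := add_nonneg (mul_nonneg α.2.1 (p.prob_nonneg A))
    (mul_nonneg (sub_nonneg.2 α.2.2) (q.prob_nonneg A))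
  prob_univ := by rw [p.prob_univ, q.prob_univ]; ring
  prob_union A B h := by rw [p.prob_union A B h, q.prob_union A B h]; ring

/-- `p ≪ q`. -/
def FinProb.AbsCont (p q : FinProb S) : Prop :=
  ∀ A, q.prob A = 0 → p.prob A = 0

/-- Countable additivity. -/
def FinProb.CountablyAdditive (p : FinProb S) : Prop :=
  ∀ A : ℕ → {A : Set S // MeasurableSet A}, Pairwise (fun i j => Disjoint (A i).1 (A j).1) →
    HasSum (fun i => p.prob (A i)) (p.prob ⟨⋃ i, (A i).1, MeasurableSet.iUnion fun i => (A i).2⟩)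

variable (S) in
/-- The set `Δ^σ` of countably additive probabilities, with the relative weak* topology. -/
abbrev SigmaProb : Type _ := {p : FinProb S // p.CountablyAdditive}

/-- The mixture `α p + (1 - α) q` of countably additive probabilities. -/
noncomputable def SigmaProb.mix (α : I) (p q : SigmaProb S) : SigmaProb S :=
  ⟨FinProb.mix α p.1 q.1, fun A hA => ((p.2 A hA).mul_left _).add ((q.2 A hA).mul_left _)⟩

/-- Convex subsets of `Δ`. -/
def ConvexModels (C : Set (FinProb S)) : Prop :=
  ∀ p ∈ C, ∀ q ∈ C, ∀ α : I, FinProb.mix α p q ∈ C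

/-- The weak* closure of the convex hull of a subset of `Δ`. -/
def closedHull (C : Set (FinProb S)) : Set (FinProb S) :=
  closure (⋂₀ {D | C ⊆ D ∧ ConvexModels D})

variable (S) in
/-- The collection `𝒦` of non-empty, compact and convex subsets of `Δ^σ`. -/
structure ModelSet where
  /-- the underlying set of models -/
  carrier : Set (SigmaProb S)
  nonempty : carrier.Nonempty
  compact : IsCompact carrier
  convex : ∀ p ∈ carrier, ∀ q ∈ carrier, ∀ α : I, SigmaProb.mix α p q ∈ carrier

/-- The set `{q}`. -/
def ModelSet.single (q : SigmaProb S) : ModelSet S where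
  carrier := {q}
  nonempty := ⟨q, rfl⟩
  compact := isCompact_singleton
  convex := by
    rintro p rfl q rfl α
    refine Subtype.ext (FinProb.ext (funext fun A => ?_))
    change (α : ℝ) * _ + (1 - (α : ℝ)) * _ = _
    ring

/-! ### Statistical distances and divergences -/

/-- `k` is grounded: its infimum is `0`. -/
def Grounded (k : FinProb S → ℝ≥0∞) : Prop := ⨅ p, k p = 0

/-- Convexity of an extended-valued function on `Δ` (with `0 · ∞ = 0`). -/
def ConvexFn (k : FinProb S → ℝ≥0∞) : Prop :=
  ∀ p p' (α : I), k (FinProb.mix α p p') ≤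
    ENNReal.ofReal (α : ℝ) * k p + ENNReal.ofReal (1 - (α : ℝ)) * k p'

/-- Joint convexity of a function on `Δ × Δ^σ`. -/
def JointlyConvex (c : FinProb S → SigmaProb S → ℝ≥0∞) : Prop :=
  ∀ p p' q q' (α : I), c (FinProb.mix α p p') (SigmaProb.mix α q q') ≤
    ENNReal.ofReal (α : ℝ) * c p q + ENNReal.ofReal (1 - (α : ℝ)) * c p' q'

/-- Joint lower semicontinuity of a function on `Δ × Δ^σ`. -/
def JointlyLsc (c : FinProb S → SigmaProb S → ℝ≥0∞) : Prop :=
  LowerSemicontinuous fun z : FinProb S × SigmaProb S => c z.1 z.2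

/-- The restriction of `c` to `Δ × Q` is a statistical distance for `Q`. -/
structure IsStatDistance (Q : Set (SigmaProb S)) (c : FinProb S → SigmaProb S → ℝ≥0∞) :
    Prop where
  grounded : ∀ q ∈ Q, Grounded fun p => c p q
  lsc : ∀ q ∈ Q, LowerSemicontinuous fun p => c p q
  convex : ∀ q ∈ Q, ConvexFn fun p => c p q
  eq_zero_iff : ∀ p, ∀ q ∈ Q, c p q = 0 ↔ p = q.1

/-- `c_Q (p) = min_{q ∈ Q} c (p, q)`. -/
noncomputable def distTo (c : FinProb S → SigmaProb S → ℝ≥0∞) (Q : Set (SigmaProb S))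
    (p : FinProb S) : ℝ≥0∞ := ⨅ q ∈ Q, c p q

/-- The restriction of `c` to `Δ × Q` is a variational divergence for `Q`. -/
structure IsVariationalDivergenceFor (Q : Set (SigmaProb S))
    (c : FinProb S → SigmaProb S → ℝ≥0∞) : Prop where
  statDistance : IsStatDistance Q c
  /-- the minimum that defines `c_Q` is attained -/
  min_attained : ∀ p, ∃ q ∈ Q, c p q = distTo c Q p
  grounded : Grounded (distTo c Q)
  lsc : LowerSemicontinuous (distTo c Q)
  convex : ConvexFn (distTo c Q)
  absCont : ∀ p, ∀ q ∈ Q, c p q < ∞ → p.AbsCont q.1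

/-- `c` is a (universal) variational divergence: a statistical distance on `Δ × Δ^σ` whose
restriction to each compact convex `Q ⊆ Δ^σ` is a variational divergence for `Q`. -/
structure IsVariationalDivergence (c : FinProb S → SigmaProb S → ℝ≥0∞) : Prop where
  statDistance : IsStatDistance Set.univ c
  restrict : ∀ Q : ModelSet S, IsVariationalDivergenceFor Q.carrier c

end Prob

/-! ### Acts and preferences -/

section Acts

variable {S : Type*} [MeasurableSpace S] {E : Type*} [AddCommGroup E] [Module ℝ E] {X : Set E}

variable (S X) in
/-- Simple acts: finite-valued measurable functions from states to consequences. -/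
abbrev Act : Type _ := SimpleFunc S X

variable (S) in
/-- The constant act `x`. -/
abbrev constAct (x : X) : Act S X := SimpleFunc.const S x

/-- The consequence `α x + (1 - α) y`. -/
def mixX (hX : Convex ℝ X) (α : I) (x y : X) : X :=
  ⟨(α : ℝ) • (x : E) + (1 - (α : ℝ)) • (y : E),
    hX x.2 y.2 α.2.1 (sub_nonneg.2 α.2.2) (by ring)⟩

/-- The act `α f + (1 - α) g`, mixed state by state. -/
def mixAct (hX : Convex ℝ X) (α : I) (f g : Act S X) : Act S X :=
  (f.pair g).map fun z => mixX hX α z.1 z.2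

/-- The number `1/2` of the unit interval. -/
noncomputable def oneHalf : I := ⟨1 / 2, by norm_num, by norm_num⟩

/-- The asymmetric part `≻`. -/
def Strict (R : Act S X → Act S X → Prop) (f g : Act S X) : Prop := R f g ∧ ¬ R g f

/-- The symmetric part `∼`. -/
def Indiff (R : Act S X → Act S X → Prop) (f g : Act S X) : Prop := R f g ∧ R g f

/-- A preference: a binary relation on acts that satisfies the basic conditions. -/
structure IsPreference (hX : Convex ℝ X) (R : Act S X → Act S X → Prop) : Prop where
  refl : ∀ f, R f f
  trans : ∀ f g h, R f g → R g h → R f h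
  monotone : ∀ f g, (∀ s, R (constAct S (f s)) (constAct S (g s))) → R f g
  continuous_left : ∀ f g h, IsClosed {α : I | R (mixAct hX α f g) h}
  continuous_right : ∀ f g h, IsClosed {α : I | R h (mixAct hX α f g)}
  nontrivial : ∃ f g, Strict R f g

/-- Unbounded relations. -/
def IsUnbounded (hX : Convex ℝ X) (R : Act S X → Act S X → Prop) : Prop :=
  ∀ x y : X, Strict R (constAct S x) (constAct S y) → ∃ z z' : X,
    R (constAct S (mixX hX oneHalf z y)) (constAct S x) ∧
    R (constAct S y) (constAct S (mixX hX oneHalf x z'))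

/-- (Subjectively) rational preferences. -/
structure IsRational (hX : Convex ℝ X) (R : Act S X → Act S X → Prop) : Prop where
  preference : IsPreference hX R
  complete : ∀ f g, R f g ∨ R g f
  risk_independent : ∀ (x y z : X) (α : I), 0 < α → α < 1 →
    Indiff R (constAct S x) (constAct S y) →
    Indiff R (constAct S (mixX hX α x z)) (constAct S (mixX hX α y z))

/-- Dominance relations, relative to the set of models `Q`. -/
structure IsDominance (hX : Convex ℝ X) (Q : Set (SigmaProb S))
    (R : Act S X → Act S X → Prop) : Prop where
  preference : IsPreference hX R
  c_complete : ∀ x y : X, R (constAct S x) (constAct S y) ∨ R (constAct S y) (constAct S x)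
  complete : (∃ q, Q = {q}) → ∀ f g, R f g ∨ R g f
  weak_c_independent : ∀ (f g : Act S X) (x y : X) (α : I), 0 < α → α < 1 →
    R (mixAct hX α f (constAct S x)) (mixAct hX α g (constAct S x)) →
    R (mixAct hX α f (constAct S y)) (mixAct hX α g (constAct S y))
  convex : ∀ (f g h : Act S X) (α : I), 0 < α → α < 1 → R f h → R g h → R (mixAct hX α f g) h

/-- The event that two acts agree. -/
def agree (f g : Act S X) : {A : Set S // MeasurableSet A} :=
  ⟨{s | f s = g s}, (f.pair g).measurableSet_preimage {z | z.1 = z.2}⟩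

/-- Objective `Q`-coherence of `≿*`. -/
def ObjCoherent (Q : Set (SigmaProb S)) (R : Act S X → Act S X → Prop) : Prop :=
  ∀ f g, (∀ q ∈ Q, q.1.prob (agree f g) = 1) → Indiff R f g

/-- Affine functions on the consequence space. -/
def IsAffine (hX : Convex ℝ X) (u : X → ℝ) : Prop :=
  ∀ (α : I) (x y : X), u (mixX hX α x y) = (α : ℝ) * u x + (1 - (α : ℝ)) * u y

/-- The indifference class `X_f^p`: the consequences `y` with `u (y) = ∫ u (f) dp`, where `u` is an
affine utility that represents `R` on consequences. -/
def modelEquiv (hX : Convex ℝ X) (R : Act S X → Act S X → Prop) (f : Act S X) (p : FinProb S) :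
    Set X :=
  {y | ∃ u : X → ℝ, IsAffine hX u ∧ (∀ x x', R (constAct S x) (constAct S x') ↔ u x' ≤ u x) ∧
    u y = p.integral (f.map u)}

/-- Subjective `Q`-coherence, for the dominance relation `Rs` and the behavioral preference `R`. -/
def SubjCoherent (hX : Convex ℝ X) (Q : Set (SigmaProb S)) (Rs R : Act S X → Act S X → Prop) :
    Prop :=
  ∀ p : FinProb S,
    (∀ (f : Act S X) (x : X), ∀ y ∈ modelEquiv hX R f p,
      Strict Rs (constAct S x) (constAct S y) → Strict R (constAct S x) f) ↔
    p ∈ closedHull (Subtype.val '' Q)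

/-- Consistency of the pair `(Rs, R)`. -/
def Consistency (Rs R : Act S X → Act S X → Prop) : Prop := ∀ f g, Rs f g → R f g

/-- Caution of the pair `(Rs, R)`. -/
def Caution (Rs R : Act S X → Act S X → Prop) : Prop :=
  ∀ (x : X) (f : Act S X), ¬ Rs f (constAct S x) → R (constAct S x) f

/-! ### Families of preferences indexed by the compact convex sets of models -/

/-- `y` is a consequence `x_{f,q}`: it is indifferent to `f` for the relation `≿*_q`. -/
def IsCertEquiv (star : ModelSet S → Act S X → Act S X → Prop) (f : Act S X) (q : SigmaProb S)
    (y : X) : Prop :=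
  Indiff (star (ModelSet.single q)) f (constAct S y)

/-- Misspecification robust two-preference families, `star Q` being `≿*_Q` and `pref Q`
being `≿_Q`. -/
structure IsRobust (hX : Convex ℝ X) (star pref : ModelSet S → Act S X → Act S X → Prop) :
    Prop where
  monotone : ∀ Q Q' : ModelSet S, Q'.carrier ⊆ Q.carrier → ∀ f g, star Q f g → star Q' f g
  separable : ∀ (Q : ModelSet S) (f g : Act S X),
    (∀ q ∈ Q.carrier, star (ModelSet.single q) f g) → star Q f g
  lsc : ∀ (x : X) (f : Act S X), IsClosed {q : SigmaProb S | ∃ y, IsCertEquiv star f q y ∧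
    star (ModelSet.single q) (constAct S x) (constAct S y)}
  dominance : ∀ Q, IsDominance hX Q.carrier (star Q)
  unbounded : ∀ Q, IsUnbounded hX (star Q)
  rational : ∀ Q, IsRational hX (pref Q)
  objCoherent : ∀ Q, ObjCoherent Q.carrier (star Q)
  subjCoherent : ∀ Q, SubjCoherent hX Q.carrier (star Q) (pref Q)
  caution : ∀ Q, Caution (star Q) (pref Q)
  consistency : ∀ Q, Consistency (star Q) (pref Q)

/-- Model hybridization aversion. -/
def HybridizationAverse (hX : Convex ℝ X) (star : ModelSet S → Act S X → Act S X → Prop) : Prop :=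
  ∀ (q q' : SigmaProb S) (α : I), 0 < α → α < 1 → ∀ (f : Act S X) (y y' z : X),
    IsCertEquiv star f q y → IsCertEquiv star f q' y' →
    IsCertEquiv star f (SigmaProb.mix α q q') z →
    ∀ Q, star Q (constAct S (mixX hX α y y')) (constAct S z)

/-- The function `p ↦ ∫ u (f) dp + k (p)`. -/
noncomputable def objective (u : X → ℝ) (k : FinProb S → ℝ≥0∞) (f : Act S X) (p : FinProb S) :
    EReal :=
  ((p.integral (f.map u) : ℝ) : EReal) + (k p : EReal)

/-- `min_{p ∈ Δ} {∫ u (f) dp + k (p)}`. -/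
noncomputable def value (u : X → ℝ) (k : FinProb S → ℝ≥0∞) (f : Act S X) : EReal :=
  ⨅ p, objective u k f p

/-- The pair `(u, c)` is a representation of the family: `u` is affine and onto, `c` is a lower
semicontinuous and convex variational divergence, and all the minima in the two criteria are
attained. -/
structure IsRepresentation (hX : Convex ℝ X) (star pref : ModelSet S → Act S X → Act S X → Prop)
    (u : X → ℝ) (c : FinProb S → SigmaProb S → ℝ≥0∞) : Prop where
  affine : IsAffine hX u
  onto : Function.Surjective u
  lsc : JointlyLsc c
  convex : JointlyConvex c
  divergence : IsVariationalDivergence c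
  min_star : ∀ (q : SigmaProb S) (f : Act S X),
    ∃ p, objective u (fun p => c p q) f p = value u (fun p => c p q) f
  min_pref : ∀ (Q : ModelSet S) (f : Act S X),
    ∃ p, objective u (distTo c Q.carrier) f p = value u (distTo c Q.carrier) f
  star_iff : ∀ (Q : ModelSet S) (f g : Act S X), star Q f g ↔
    ∀ q ∈ Q.carrier, value u (fun p => c p q) g ≤ value u (fun p => c p q) f
  pref_iff : ∀ (Q : ModelSet S) (f g : Act S X), pref Q f g ↔
    value u (distTo c Q.carrier) g ≤ value u (distTo c Q.carrier) f

end Acts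

end Misspec

/-! Everything passes through duality between penalties on `Δ` and concave niveloids `J`, the
monotone, translation-invariant, concave functionals of utility profiles with `J 0 = 0`. Since `u`
is onto, every real simple function is the profile of an act. A lower semicontinuous penalty `k`
with a zero yields the niveloid `φ ↦ min_p {∫ φ dp + k p}`, and `J` yields the penalty `p ↦ sup_φ {J
φ - ∫ φ dp}`. The two operations are mutually inverse once `k` is convex: Hahn-Banach gives
probabilities as supergradients (`penalized_conjugate`), and separation gives the Fenchel-Moreau
half (`conjugate_penalized`).

From axioms to representation, the mixture space theorem gives an affine utility, common to all `Q`.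
Each complete `≿*_q` is then represented by a niveloid `J q`, and `c (·, q)` is its conjugate. As a
supremum over `φ`, `c` is jointly lower semicontinuous because `q ↦ J q φ` is, by the semicontinuity
axiom, and jointly convex because `q ↦ J q φ` is convex, by hybridization aversion. Objective
coherence gives absolute continuity; subjective coherence on singletons gives `c (p, q) = 0 ↔ p =
q`. Separability and monotonicity make `≿*_Q` the unanimity of the `J q`, while caution and
consistency force the certainty equivalents of `≿_Q` to be `min_{q ∈ Q} J q`, which is the criterion
with penalty `c_Q`.

Conversely, attained minima over `p` and `q` can be exchanged, which gives caution and consistency.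
Biconjugation identifies the probabilities accepted by subjective coherence with the zeros of `c_Q`,
namely `Q`. Biconjugation also makes `c` unique given `u`. -/

namespace Misspec

/-! ### Integration against finitely additive probabilities and weak* compactness. -/

section FinitelyAdditive

variable {S : Type*} [MeasurableSpace S]

/-- The set function `A ↦ (t ↦ p A * t)`, extended by zero to non-measurable sets. -/
noncomputable def FinProb.toSetFun (p : FinProb S) (A : Set S) : ℝ →L[ℝ] ℝ :=
  open Classical in
  (if h : MeasurableSet A then p.prob ⟨A, h⟩ else 0) • ContinuousLinearMap.id ℝ ℝ

theorem FinProb.toSetFun_apply (p : FinProb S) {A : Set S} (h : MeasurableSet A) (t : ℝ) :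
    p.toSetFun A t = p.prob ⟨A, h⟩ * t := by
  simp [FinProb.toSetFun, h]

/-- The zero measure is a dummy: every event has finite measure and every simple function is
integrable under it, so linearity of `setToSimpleFunc` applies without side conditions. -/
theorem FinProb.toSetFun_additive (p : FinProb S) :
    FinMeasAdditive (0 : Measure S) p.toSetFun := by
  intro A B hA hB _ _ hAB
  ext
  rw [p.toSetFun_apply (hA.union hB), _root_.add_apply, p.toSetFun_apply hA,
    p.toSetFun_apply hB, p.prob_union ⟨A, hA⟩ ⟨B, hB⟩ hAB, add_mul]

theorem SimpleFunc.integrable_zero_measure {F : Type*} [NormedAddCommGroup F]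
    (φ : SimpleFunc S F) : Integrable φ (0 : Measure S) :=
  MeasureTheory.integrable_zero_measure

theorem FinProb.integral_eq_setToSimpleFunc (p : FinProb S) (φ : SimpleFunc S ℝ) :
    p.integral φ = φ.setToSimpleFunc p.toSetFun := by
  rw [FinProb.integral, SimpleFunc.setToSimpleFunc]
  exact Finset.sum_congr rfl fun t _ => by
    rw [p.toSetFun_apply (φ.measurableSet_fiber t), mul_comm]

theorem FinProb.integral_add (p : FinProb S) (φ ψ : SimpleFunc S ℝ) :
    p.integral (φ + ψ) = p.integral φ + p.integral ψ := by
  simp only [p.integral_eq_setToSimpleFunc]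
  exact SimpleFunc.setToSimpleFunc_add _ p.toSetFun_additive
    (SimpleFunc.integrable_zero_measure φ) (SimpleFunc.integrable_zero_measure ψ)

theorem FinProb.integral_smul (p : FinProb S) (a : ℝ) (φ : SimpleFunc S ℝ) :
    p.integral (a • φ) = a * p.integral φ := by
  simp only [p.integral_eq_setToSimpleFunc]
  exact SimpleFunc.setToSimpleFunc_smul_real _ p.toSetFun_additive a
    (SimpleFunc.integrable_zero_measure φ)

/-- Integration against a finitely additive probability as a linear functional. -/
noncomputable def FinProb.integralLM (p : FinProb S) : SimpleFunc S ℝ →ₗ[ℝ] ℝ where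
  toFun := p.integral
  map_add' := p.integral_add
  map_smul' := p.integral_smul

@[simp] theorem FinProb.integralLM_apply (p : FinProb S) (φ : SimpleFunc S ℝ) :
    p.integralLM φ = p.integral φ := rfl

theorem FinProb.integral_sub (p : FinProb S) (φ ψ : SimpleFunc S ℝ) :
    p.integral (φ - ψ) = p.integral φ - p.integral ψ := map_sub p.integralLM φ ψ

theorem FinProb.prob_empty (p : FinProb S) : p.prob ⟨∅, MeasurableSet.empty⟩ = 0 := by
  have h := p.prob_union ⟨∅, MeasurableSet.empty⟩ ⟨∅, MeasurableSet.empty⟩ (by simp)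
  simp only [Set.union_empty] at h
  linarith

theorem FinProb.integral_nonneg (p : FinProb S) {φ : SimpleFunc S ℝ} (h : ∀ s, 0 ≤ φ s) :
    0 ≤ p.integral φ := by
  refine Finset.sum_nonneg fun t ht => mul_nonneg ?_ (p.prob_nonneg _)
  obtain ⟨s, rfl⟩ := SimpleFunc.mem_range.1 ht
  exact h s

theorem FinProb.integral_mono (p : FinProb S) {φ ψ : SimpleFunc S ℝ} (h : ∀ s, φ s ≤ ψ s) :
    p.integral φ ≤ p.integral ψ := by
  have := p.integral_nonneg (φ := ψ - φ) fun s => sub_nonneg.2 (h s)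
  rw [p.integral_sub] at this
  linarith

theorem FinProb.integral_const [Nonempty S] (p : FinProb S) (t : ℝ) :
    p.integral (SimpleFunc.const S t) = t := by
  have h : p.prob ⟨(SimpleFunc.const S t) ⁻¹' {t}, SimpleFunc.measurableSet_fiber _ t⟩ = 1 := by
    rw [← p.prob_univ]
    congr 2
    ext; simp
  rw [FinProb.integral, SimpleFunc.range_const, Finset.sum_singleton, h, mul_one]

/-- The indicator function of an event. -/
noncomputable def eventInd (A : {A : Set S // MeasurableSet A}) : SimpleFunc S ℝ :=
  SimpleFunc.piecewise A.1 A.2 (SimpleFunc.const S 1) (SimpleFunc.const S 0)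

theorem eventInd_apply (A : {A : Set S // MeasurableSet A}) (s : S) :
    eventInd A s = A.1.indicator (fun _ => (1 : ℝ)) s := by
  simp only [eventInd, SimpleFunc.coe_piecewise, SimpleFunc.coe_const]
  by_cases h : s ∈ A.1 <;> simp [h]

theorem FinProb.integral_eventInd (p : FinProb S) (A : {A : Set S // MeasurableSet A}) :
    p.integral (eventInd A) = p.prob A := by
  rw [p.integral_eq_setToSimpleFunc, eventInd]
  have h0 : p.toSetFun ∅ = 0 := by
    ext; rw [p.toSetFun_apply MeasurableSet.empty, p.prob_empty]; simp
  have := SimpleFunc.setToSimpleFunc_indicator p.toSetFun h0 A.2 (1 : ℝ)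
  rw [p.toSetFun_apply A.2, mul_one] at this
  exact this

theorem FinProb.ext_integral {p q : FinProb S} (h : ∀ φ, p.integral φ = q.integral φ) : p = q :=
  FinProb.ext (funext fun A => by
    rw [← p.integral_eventInd, ← q.integral_eventInd, h])

theorem SimpleFunc.eq_sum_eventInd (φ : SimpleFunc S ℝ) :
    φ = ∑ t ∈ φ.range, t • eventInd ⟨φ ⁻¹' {t}, φ.measurableSet_fiber t⟩ := by
  ext s
  have key : ∀ F : Finset ℝ, (∑ t ∈ F, t • eventInd ⟨φ ⁻¹' {t}, φ.measurableSet_fiber t⟩ :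
      SimpleFunc S ℝ) s = ∑ t ∈ F, if φ s = t then t else 0 := by
    intro F
    induction F using Finset.induction_on with
    | empty => simp
    | insert a F ha ih =>
      rw [Finset.sum_insert ha, Finset.sum_insert ha, SimpleFunc.add_apply, ih,
        SimpleFunc.smul_apply, eventInd_apply]
      congr 1
      by_cases h : φ s = a <;> simp [h]
  rw [key, Finset.sum_ite_eq]
  simp

/-- Positive normalized linear functionals on simple functions are integrals. -/
theorem FinProb.exists_integral_eq (L : SimpleFunc S ℝ →ₗ[ℝ] ℝ)
    (hpos : ∀ φ : SimpleFunc S ℝ, (∀ s, 0 ≤ φ s) → 0 ≤ L φ) (hone : L (SimpleFunc.const S 1) = 1) :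
    ∃ p : FinProb S, ∀ φ, p.integral φ = L φ := by
  refine ⟨⟨fun A => L (eventInd A), fun A => hpos _ fun s => ?_, ?_, fun A B hAB => ?_⟩,
    fun φ => ?_⟩
  · rw [eventInd_apply]
    exact Set.indicator_nonneg (fun _ _ => zero_le_one) s
  · rw [← hone]
    congr 1
    ext s
    simp [eventInd_apply]
  · rw [← map_add]
    congr 1
    ext s
    simp only [SimpleFunc.coe_add, Pi.add_apply, eventInd_apply]
    exact congrFun (Set.indicator_union_of_disjoint hAB _) s
  · conv_rhs => rw [SimpleFunc.eq_sum_eventInd φ]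
    rw [map_sum]
    simp only [map_smul, smul_eq_mul]
    rfl

theorem FinProb.integral_mix (α : I) (p q : FinProb S) (φ : SimpleFunc S ℝ) :
    (FinProb.mix α p q).integral φ = (α : ℝ) * p.integral φ + (1 - (α : ℝ)) * q.integral φ := by
  simp only [FinProb.integral, Finset.mul_sum, ← Finset.sum_add_distrib]
  refine Finset.sum_congr rfl fun t _ => ?_
  simp only [FinProb.mix]
  ring

theorem FinProb.mix_self (α : I) (p : FinProb S) : FinProb.mix α p p = p :=
  FinProb.ext (funext fun A => by simp only [FinProb.mix]; ring)

theorem FinProb.continuous_integral (φ : SimpleFunc S ℝ) :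
    Continuous fun p : FinProb S => p.integral φ := by
  have h : Continuous fun (p : FinProb S) (ψ : SimpleFunc S ℝ) => p.integral ψ :=
    continuous_induced_dom
  exact (continuous_apply φ).comp h

theorem SimpleFunc.exists_abs_le (φ : SimpleFunc S ℝ) : ∃ M : ℝ, ∀ s, |φ s| ≤ M := by
  obtain ⟨M, hM⟩ := (φ.map (fun t => |t|)).range.bddAbove
  refine ⟨M, fun s => hM ?_⟩
  exact SimpleFunc.mem_range_self (φ.map (fun t => |t|)) s

theorem FinProb.abs_integral_le [Nonempty S] (p : FinProb S) {φ : SimpleFunc S ℝ} {M : ℝ}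
    (h : ∀ s, |φ s| ≤ M) : |p.integral φ| ≤ M := by
  rw [abs_le]
  constructor
  · rw [← p.integral_const (-M)]
    exact p.integral_mono fun s => (abs_le.1 (h s)).1
  · rw [← p.integral_const M]
    exact p.integral_mono fun s => (abs_le.1 (h s)).2

instance FinProb.instT2Space : T2Space (FinProb S) :=
  T2Space.of_injective_continuous (f := fun (p : FinProb S) (φ : SimpleFunc S ℝ) => p.integral φ)
    (fun _ _ h => FinProb.ext_integral fun φ => congrFun h φ) continuous_induced_dom

/-- As in Banach-Alaoglu, `Δ` embeds in a product of compact intervals; its image is closed because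
additivity, homogeneity, positivity and normalization are closed pointwise conditions. -/
instance FinProb.instCompactSpace [Nonempty S] : CompactSpace (FinProb S) := by
  choose M hM using SimpleFunc.exists_abs_le (S := S)
  have hind : IsInducing fun (p : FinProb S) (φ : SimpleFunc S ℝ) => p.integral φ := ⟨rfl⟩
  have hK : IsCompact (Set.univ.pi fun φ : SimpleFunc S ℝ => Set.Icc (-M φ) (M φ)) :=
    isCompact_univ_pi fun φ => isCompact_Icc
  rw [← isCompact_univ_iff, hind.isCompact_iff, image_univ]
  refine hK.of_isClosed_subset ?_ ?_
  · have : range (fun (p : FinProb S) (φ : SimpleFunc S ℝ) => p.integral φ) =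
        {w | (∀ φ ψ, w (φ + ψ) = w φ + w ψ) ∧ (∀ (a : ℝ) φ, w (a • φ) = a * w φ) ∧
          (∀ φ, (∀ s, 0 ≤ φ s) → 0 ≤ w φ) ∧ w (SimpleFunc.const S 1) = 1} := by
      ext w
      constructor
      · rintro ⟨p, rfl⟩
        exact ⟨p.integral_add, p.integral_smul, fun φ h => p.integral_nonneg h,
          p.integral_const 1⟩
      · rintro ⟨h1, h2, h3, h4⟩
        obtain ⟨p, hp⟩ := FinProb.exists_integral_eq ⟨⟨w, h1⟩, h2⟩ h3 h4
        exact ⟨p, funext hp⟩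
    rw [this]
    simp only [ofPred_and, ofPred_forall]
    refine ((isClosed_iInter fun φ => isClosed_iInter fun ψ => ?_).inter
      ((isClosed_iInter fun a => isClosed_iInter fun φ => ?_).inter
      ((isClosed_iInter fun φ => isClosed_iInter fun _ => ?_).inter ?_)))
    · exact isClosed_eq (continuous_apply _) (by fun_prop)
    · exact isClosed_eq (continuous_apply _) (continuous_const.mul (continuous_apply _))
    · exact isClosed_le continuous_const (continuous_apply _)
    · exact isClosed_eq (continuous_apply _) continuous_const
  · rintro _ ⟨p, rfl⟩ φ _
    exact abs_le.1 (p.abs_integral_le (hM φ))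

theorem FinProb.prob_compl (p : FinProb S) (A : {A : Set S // MeasurableSet A}) :
    p.prob ⟨A.1ᶜ, A.2.compl⟩ = 1 - p.prob A := by
  have h := p.prob_union A ⟨A.1ᶜ, A.2.compl⟩ disjoint_compl_right
  simp only [Set.union_compl_self, p.prob_univ] at h
  linarith

theorem FinProb.integral_congr_of_prob_eq_zero (p : FinProb S) (A : {A : Set S // MeasurableSet A})
    (hA : p.prob A = 0) {φ ψ : SimpleFunc S ℝ} (h : ∀ s ∉ A.1, φ s = ψ s) :
    p.integral φ = p.integral ψ := by
  obtain ⟨M, hM⟩ := SimpleFunc.exists_abs_le (φ - ψ)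
  have h1 : p.integral (φ - ψ) ≤ p.integral (M • eventInd A) := by
    refine p.integral_mono fun s => ?_
    rw [SimpleFunc.smul_apply, eventInd_apply]
    by_cases hs : s ∈ A.1
    · simpa [hs] using (abs_le.1 (hM s)).2
    · simp [hs, h s hs]
  have h2 : p.integral ((-M) • eventInd A) ≤ p.integral (φ - ψ) := by
    refine p.integral_mono fun s => ?_
    rw [SimpleFunc.smul_apply, eventInd_apply]
    by_cases hs : s ∈ A.1
    · simpa [hs] using (abs_le.1 (hM s)).1
    · simp [hs, h s hs]
  rw [p.integral_smul, p.integral_eventInd, hA, mul_zero, p.integral_sub] at h1 h2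
  linarith

/-- `Q` is its own convex hull, and its compact image is closed since `Δ` is Hausdorff. -/
theorem ModelSet.closedHull_carrier (Q : ModelSet S) :
    closedHull (Subtype.val '' Q.carrier) = Subtype.val '' Q.carrier := by
  have h : ⋂₀ {D | Subtype.val '' Q.carrier ⊆ D ∧ ConvexModels D} = Subtype.val '' Q.carrier := by
    refine subset_antisymm (sInter_subset_of_mem ⟨subset_rfl, ?_⟩) (subset_sInter fun D hD => hD.1)
    rintro _ ⟨p, hp, rfl⟩ _ ⟨q, hq, rfl⟩ α
    exact ⟨_, Q.convex p hp q hq α, rfl⟩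
  rw [closedHull, h]
  exact (Q.compact.image continuous_subtype_val).isClosed.closure_eq

/-- The point mass at `s`. -/
noncomputable def dirac (s : S) : SigmaProb S :=
  ⟨{ prob := fun A => A.1.indicator (fun _ => (1 : ℝ)) s
     prob_nonneg := fun A => Set.indicator_nonneg (fun _ _ => zero_le_one) s
     prob_univ := by simp
     prob_union := fun A B h => congrFun (Set.indicator_union_of_disjoint h _) s }, by
    intro A hA
    by_cases h : ∃ i, s ∈ (A i).1
    · obtain ⟨i, hi⟩ := h
      have hu : s ∈ ⋃ i, (A i).1 := mem_iUnion.2 ⟨i, hi⟩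
      have := hasSum_single (f := fun j => (A j).1.indicator (fun _ => (1 : ℝ)) s) i
        fun j hj => Set.indicator_of_notMem
          (fun hs => Set.disjoint_left.1 (hA hj) hs hi) _
      simpa only [Set.indicator_of_mem hi, Set.indicator_of_mem hu] using this
    · have hu : s ∉ ⋃ i, (A i).1 := fun hs => h (mem_iUnion.1 hs)
      push Not at h
      simp [h, hu]⟩

instance [Nonempty S] : Nonempty (SigmaProb S) := ⟨dirac (Classical.arbitrary S)⟩

theorem continuous_finProb_of_integral {Y : Type*} [TopologicalSpace Y] {g : Y → FinProb S}
    (h : ∀ φ, Continuous fun y => (g y).integral φ) : Continuous g :=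
  continuous_induced_rng.2 (continuous_pi h)

/-- The segment between two models. -/
noncomputable def ModelSet.segment (q q' : SigmaProb S) : ModelSet S where
  carrier := range fun α : I => SigmaProb.mix α q q'
  nonempty := ⟨_, 0, rfl⟩
  compact := by
    refine isCompact_range ((continuous_finProb_of_integral fun φ => ?_).subtype_mk _)
    simp only [FinProb.integral_mix]
    fun_prop
  convex := by
    rintro _ ⟨a, rfl⟩ _ ⟨b, rfl⟩ α
    refine ⟨⟨α * a + (1 - α) * b, ?_, ?_⟩, Subtype.ext (FinProb.ext (funext fun A => ?_))⟩
    · have := α.2.1; have := a.2.1; have := b.2.1; have := sub_nonneg.2 α.2.2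
      positivity
    · nlinarith [α.2.1, α.2.2, a.2.2, b.2.2, a.2.1, b.2.1]
    · simp only [SigmaProb.mix, FinProb.mix]
      ring

theorem ModelSet.left_mem_segment (q q' : SigmaProb S) : q ∈ (ModelSet.segment q q').carrier :=
  ⟨1, Subtype.ext (FinProb.ext (funext fun A => by simp [SigmaProb.mix, FinProb.mix]))⟩

theorem ModelSet.right_mem_segment (q q' : SigmaProb S) : q' ∈ (ModelSet.segment q q').carrier :=
  ⟨0, Subtype.ext (FinProb.ext (funext fun A => by simp [SigmaProb.mix, FinProb.mix]))⟩

end FinitelyAdditive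

end Misspec

namespace Misspec

/-! ### Duality between penalties and concave niveloids. -/

section Penalties

variable {S : Type*} [MeasurableSpace S]

/-- A penalty: a lower semicontinuous function on `Δ` that vanishes somewhere. -/
structure IsPenalty (k : FinProb S → ℝ≥0∞) : Prop where
  lsc : LowerSemicontinuous k
  exists_zero : ∃ p, k p = 0

/-- The real number `min_p {∫ φ dp + k (p)}`. -/
noncomputable def penalized (k : FinProb S → ℝ≥0∞) (φ : SimpleFunc S ℝ) : ℝ :=
  ⨅ p : {p // k p ≠ ∞}, (p.1.integral φ + (k p.1).toReal)

/-- Concave niveloids: monotone, translation invariant, concave functionals vanishing at `0`. -/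
structure IsConcaveNiveloid (J : SimpleFunc S ℝ → ℝ) : Prop where
  mono : ∀ φ ψ : SimpleFunc S ℝ, (∀ s, φ s ≤ ψ s) → J φ ≤ J ψ
  add_const : ∀ (φ : SimpleFunc S ℝ) (t : ℝ), J (φ + SimpleFunc.const S t) = J φ + t
  concave : ∀ (φ ψ : SimpleFunc S ℝ) (a : ℝ), 0 ≤ a → a ≤ 1 →
    a * J φ + (1 - a) * J ψ ≤ J (a • φ + (1 - a) • ψ)
  zero : J 0 = 0

/-- The conjugate `p ↦ sup_φ {J φ - ∫ φ dp}`. -/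
noncomputable def conjugate (J : SimpleFunc S ℝ → ℝ) (p : FinProb S) : ℝ≥0∞ :=
  ⨆ φ, ENNReal.ofReal (J φ - p.integral φ)

theorem IsPenalty.exists_min [Nonempty S] {k : FinProb S → ℝ≥0∞} (hk : IsPenalty k)
    (φ : SimpleFunc S ℝ) : ∃ p, k p ≠ ∞ ∧
      ∀ p', k p' ≠ ∞ → p.integral φ + (k p).toReal ≤ p'.integral φ + (k p').toReal := by
  obtain ⟨M, hM⟩ := SimpleFunc.exists_abs_le φ
  have hpos : ∀ p : FinProb S, 0 ≤ p.integral φ + M := fun p => by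
    linarith [(abs_le.1 (p.abs_integral_le hM)).1]
  -- Adding the bound `M` makes the integral nonnegative, so that the sum can be minimized in
  -- `ℝ≥0∞`.
  have hl : LowerSemicontinuous fun p : FinProb S => ENNReal.ofReal (p.integral φ + M) + k p := by
    refine LowerSemicontinuous.add (Continuous.lowerSemicontinuous ?_) hk.lsc
    exact ENNReal.continuous_ofReal.comp ((FinProb.continuous_integral φ).add continuous_const)
  obtain ⟨p0, hp0⟩ := hk.exists_zero
  obtain ⟨p, -, hp⟩ := (hl.lowerSemicontinuousOn univ).exists_isMinOn ⟨p0, mem_univ _⟩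
    isCompact_univ
  have hfin : k p ≠ ∞ := by
    intro h
    have := hp (mem_univ p0)
    simp [h, hp0] at this
  refine ⟨p, hfin, fun p' hp' => ?_⟩
  have h := hp (mem_univ p')
  simp only [mem_ofPred_eq] at h
  have h' := ENNReal.toReal_mono (ENNReal.add_ne_top.2 ⟨ENNReal.ofReal_ne_top, hp'⟩) h
  rw [ENNReal.toReal_add ENNReal.ofReal_ne_top hfin, ENNReal.toReal_add ENNReal.ofReal_ne_top hp',
    ENNReal.toReal_ofReal (hpos _), ENNReal.toReal_ofReal (hpos _)] at h'
  linarith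

/-- The infimum in `penalized` runs only over finite penalties, because `toReal` sends `∞` to `0`.
-/
theorem IsPenalty.exists_penalized_eq [Nonempty S] {k : FinProb S → ℝ≥0∞} (hk : IsPenalty k)
    (φ : SimpleFunc S ℝ) : ∃ p, k p ≠ ∞ ∧ penalized k φ = p.integral φ + (k p).toReal := by
  obtain ⟨p, hp, h⟩ := hk.exists_min φ
  refine ⟨p, hp, le_antisymm ?_ ?_⟩
  · exact ciInf_le (f := fun p : {p // k p ≠ ∞} => p.1.integral φ + (k p.1).toReal)
      ⟨p.integral φ + (k p).toReal, by rintro _ ⟨p', rfl⟩; exact h p'.1 p'.2⟩ ⟨p, hp⟩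
  · have : Nonempty {p // k p ≠ ∞} := ⟨⟨p, hp⟩⟩
    exact le_ciInf fun p' => h p'.1 p'.2

theorem IsPenalty.penalized_le [Nonempty S] {k : FinProb S → ℝ≥0∞} (hk : IsPenalty k)
    (φ : SimpleFunc S ℝ) {p : FinProb S} (hp : k p ≠ ∞) :
    penalized k φ ≤ p.integral φ + (k p).toReal := by
  obtain ⟨p', hp', h⟩ := hk.exists_min φ
  exact ciInf_le (f := fun p : {p // k p ≠ ∞} => p.1.integral φ + (k p.1).toReal)
    ⟨p'.integral φ + (k p').toReal, by rintro _ ⟨q, rfl⟩; exact h q.1 q.2⟩ ⟨p, hp⟩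

theorem IsPenalty.penalized_const [Nonempty S] {k : FinProb S → ℝ≥0∞} (hk : IsPenalty k)
    (t : ℝ) : penalized k (SimpleFunc.const S t) = t := by
  apply le_antisymm
  · obtain ⟨p, hp⟩ := hk.exists_zero
    have := hk.penalized_le (SimpleFunc.const S t) (p := p) (by simp [hp])
    simpa [hp, p.integral_const] using this
  · obtain ⟨p, hp, h⟩ := hk.exists_penalized_eq (SimpleFunc.const S t)
    rw [h, p.integral_const]
    linarith [ENNReal.toReal_nonneg (a := k p)]

theorem IsPenalty.concaveNiveloid [Nonempty S] {k : FinProb S → ℝ≥0∞} (hk : IsPenalty k) :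
    IsConcaveNiveloid (penalized k) where
  mono φ ψ h := by
    obtain ⟨p, hp, e⟩ := hk.exists_penalized_eq ψ
    rw [e]
    exact (hk.penalized_le φ hp).trans (by linarith [p.integral_mono h])
  add_const φ t := by
    apply le_antisymm
    · obtain ⟨p, hp, e⟩ := hk.exists_penalized_eq φ
      refine (hk.penalized_le _ hp).trans ?_
      rw [e, p.integral_add, p.integral_const]
      linarith
    · obtain ⟨p, hp, e⟩ := hk.exists_penalized_eq (φ + SimpleFunc.const S t)
      rw [e, p.integral_add, p.integral_const]
      linarith [hk.penalized_le φ hp]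
  concave φ ψ a h0 h1 := by
    obtain ⟨p, hp, e⟩ := hk.exists_penalized_eq (a • φ + (1 - a) • ψ)
    rw [e, p.integral_add, p.integral_smul, p.integral_smul]
    nlinarith [mul_le_mul_of_nonneg_left (hk.penalized_le φ hp) h0,
      mul_le_mul_of_nonneg_left (hk.penalized_le ψ hp) (sub_nonneg.2 h1)]
  zero := hk.penalized_const 0

namespace IsConcaveNiveloid

variable {J : SimpleFunc S ℝ → ℝ}

theorem const (hJ : IsConcaveNiveloid J) (t : ℝ) : J (SimpleFunc.const S t) = t := by
  have := hJ.add_const 0 t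
  rwa [zero_add, hJ.zero, zero_add] at this

theorem le_add (hJ : IsConcaveNiveloid J) {φ ψ : SimpleFunc S ℝ} {M : ℝ}
    (h : ∀ s, φ s ≤ ψ s + M) : J φ ≤ J ψ + M := by
  rw [← hJ.add_const]
  exact hJ.mono _ _ h

theorem abs_sub_le (hJ : IsConcaveNiveloid J) {φ ψ : SimpleFunc S ℝ} {M : ℝ}
    (h : ∀ s, |φ s - ψ s| ≤ M) : |J φ - J ψ| ≤ M := by
  rw [abs_le]
  constructor
  · have := hJ.le_add (φ := ψ) (ψ := φ) (M := M) fun s => by linarith [(abs_le.1 (h s)).1]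
    linarith
  · have := hJ.le_add (φ := φ) (ψ := ψ) (M := M) fun s => by linarith [(abs_le.1 (h s)).2]
    linarith

/-- Niveloids are 1-Lipschitz for the supremum norm; this is the source of the continuity axioms. -/
theorem continuous_segment (hJ : IsConcaveNiveloid J) (φ ψ : SimpleFunc S ℝ) :
    Continuous fun a : ℝ => J (a • φ + (1 - a) • ψ) := by
  obtain ⟨M, hM⟩ := SimpleFunc.exists_abs_le (φ - ψ)
  refine (LipschitzWith.of_dist_le_mul (K := Real.toNNReal M) fun a b => ?_).continuous
  rw [Real.dist_eq, Real.dist_eq]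
  refine (hJ.abs_sub_le (M := |a - b| * Real.toNNReal M) fun s => ?_).trans_eq (mul_comm _ _)
  have h : (a • φ + (1 - a) • ψ) s - (b • φ + (1 - b) • ψ) s = (a - b) * (φ - ψ) s := by
    simp only [SimpleFunc.coe_add, Pi.add_apply, SimpleFunc.smul_apply, SimpleFunc.coe_sub,
      Pi.sub_apply, smul_eq_mul]
    ring
  rw [h, abs_mul]
  exact mul_le_mul_of_nonneg_left ((hM s).trans (Real.le_coe_toNNReal M)) (abs_nonneg _)

/-- The decrease of `J` along `-ψ` from `φ`, per unit of length, in the infimum. -/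
noncomputable def dirDecrease (J : SimpleFunc S ℝ → ℝ) (φ ψ : SimpleFunc S ℝ) : ℝ :=
  ⨅ t : Ioi (0 : ℝ), (J φ - J (φ - (t : ℝ) • ψ)) / t

theorem bddBelow_dirDecrease (hJ : IsConcaveNiveloid J) (φ ψ : SimpleFunc S ℝ) :
    BddBelow (range fun t : Ioi (0 : ℝ) => (J φ - J (φ - (t : ℝ) • ψ)) / t) := by
  obtain ⟨M, hM⟩ := SimpleFunc.exists_abs_le ψ
  refine ⟨-M, ?_⟩
  rintro _ ⟨⟨t, ht : 0 < t⟩, rfl⟩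
  rw [le_div_iff₀ ht]
  have := hJ.le_add (φ := φ - t • ψ) (ψ := φ) (M := t * M) fun s => by
    simp only [SimpleFunc.coe_sub, Pi.sub_apply, SimpleFunc.smul_apply, smul_eq_mul]
    nlinarith [(abs_le.1 (hM s)).1]
  simp only
  linarith

theorem dirDecrease_le (hJ : IsConcaveNiveloid J) (φ ψ : SimpleFunc S ℝ) {t : ℝ} (ht : 0 < t) :
    dirDecrease J φ ψ ≤ (J φ - J (φ - t • ψ)) / t :=
  ciInf_le (hJ.bddBelow_dirDecrease φ ψ) ⟨t, ht⟩

theorem exists_lt_of_dirDecrease_lt {φ ψ : SimpleFunc S ℝ} {r : ℝ}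
    (h : dirDecrease J φ ψ < r) : ∃ t : ℝ, 0 < t ∧ (J φ - J (φ - t • ψ)) / t < r := by
  obtain ⟨⟨t, ht⟩, h⟩ := exists_lt_of_ciInf_lt h
  exact ⟨t, ht, h⟩

theorem dirDecrease_smul_le (hJ : IsConcaveNiveloid J) (φ ψ : SimpleFunc S ℝ) {c : ℝ}
    (hc : 0 < c) : dirDecrease J φ (c • ψ) ≤ c * dirDecrease J φ ψ := by
  rw [← div_le_iff₀' hc]
  refine le_of_forall_gt fun r hr => ?_
  obtain ⟨t, ht, h⟩ := exists_lt_of_dirDecrease_lt hr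
  rw [div_lt_iff₀' hc]
  refine (hJ.dirDecrease_le φ (c • ψ) (div_pos ht hc)).trans_lt ?_
  rw [smul_smul, div_mul_cancel₀ _ hc.ne']
  rw [div_div_eq_mul_div, mul_comm, mul_div_assoc]
  exact mul_lt_mul_of_pos_left h hc

/-- The weights `t / (s + t)` and `s / (s + t)` mix `φ - s • x` and `φ - t • y` into a point `φ - w
• (x + y)` with `w = s * t / (s + t)`; concavity of `J` there gives subadditivity. -/
theorem dirDecrease_add_le (hJ : IsConcaveNiveloid J) (φ x y : SimpleFunc S ℝ) :
    dirDecrease J φ (x + y) ≤ dirDecrease J φ x + dirDecrease J φ y := by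
  refine le_of_forall_pos_le_add fun ε hε => ?_
  obtain ⟨s, hs, h1⟩ := exists_lt_of_dirDecrease_lt
    (show dirDecrease J φ x < dirDecrease J φ x + ε / 2 by linarith)
  obtain ⟨t, ht, h2⟩ := exists_lt_of_dirDecrease_lt
    (show dirDecrease J φ y < dirDecrease J φ y + ε / 2 by linarith)
  have hst : 0 < s + t := add_pos hs ht
  have hw : 0 < s * t / (s + t) := by positivity
  have h3 := hJ.concave (φ - s • x) (φ - t • y) (t / (s + t)) (by positivity)
    ((div_le_one hst).2 (by linarith))
  have h4 : (t / (s + t)) • (φ - s • x) + (1 - t / (s + t)) • (φ - t • y) =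
      φ - (s * t / (s + t)) • (x + y) := by
    ext z
    simp only [SimpleFunc.coe_add, Pi.add_apply, SimpleFunc.smul_apply, SimpleFunc.coe_sub,
      Pi.sub_apply, smul_eq_mul]
    field_simp
    ring
  rw [h4] at h3
  have h5 := hJ.dirDecrease_le φ (x + y) hw
  have h6 : (J φ - J (φ - (s * t / (s + t)) • (x + y))) / (s * t / (s + t)) ≤
      (J φ - J (φ - s • x)) / s + (J φ - J (φ - t • y)) / t := by
    rw [div_le_iff₀ hw]
    have : ((J φ - J (φ - s • x)) / s + (J φ - J (φ - t • y)) / t) * (s * t / (s + t)) =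
        J φ - (t / (s + t) * J (φ - s • x) + (1 - t / (s + t)) * J (φ - t • y)) := by
      field_simp
      ring
    linarith
  linarith

/-- Concave niveloids have probabilities as supergradients. -/
theorem exists_supergradient [Nonempty S] (hJ : IsConcaveNiveloid J) (φ : SimpleFunc S ℝ) :
    ∃ p : FinProb S, ∀ ψ, J ψ - p.integral ψ ≤ J φ - p.integral φ := by
  -- Hahn-Banach, extending from the zero subspace: `L` lies below the sublinear `dirDecrease J φ`.
  obtain ⟨L, -, hL⟩ := exists_extension_of_le_sublinear (⊥ : SimpleFunc S ℝ →ₗ.[ℝ] ℝ)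
    (dirDecrease J φ) (fun c hc x => le_antisymm (hJ.dirDecrease_smul_le φ x hc) (by
      have := hJ.dirDecrease_smul_le φ (c • x) (inv_pos.2 hc)
      rwa [smul_smul, inv_mul_cancel₀ hc.ne', one_smul, ← div_eq_inv_mul, le_div_iff₀' hc] at this))
    (hJ.dirDecrease_add_le φ) (by
      rintro ⟨x, hx⟩
      obtain rfl : x = 0 := hx
      have h0 : dirDecrease J φ 0 = 0 := by simp [dirDecrease]
      rw [h0]
      exact le_of_eq (LinearPMap.map_zero _))
  -- The direction `-ψ` with step length `1` turns domination into the supergradient inequality.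
  have hsup : ∀ ψ, J (φ + ψ) - J φ ≤ L ψ := fun ψ => by
    have h1 := hL (-ψ)
    have h2 := hJ.dirDecrease_le φ (-ψ) one_pos
    rw [one_smul, sub_neg_eq_add, div_one] at h2
    rw [map_neg] at h1
    linarith
  have hpos : ∀ ψ : SimpleFunc S ℝ, (∀ s, 0 ≤ ψ s) → 0 ≤ L ψ := fun ψ h => by
    have h1 : J φ ≤ J (φ + ψ) := hJ.mono _ _ fun s => le_add_of_nonneg_right (h s)
    linarith [hsup ψ]
  have hone : L (SimpleFunc.const S 1) = 1 := by
    apply le_antisymm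
    · have h1 := hsup (SimpleFunc.const S (-1))
      have h2 : SimpleFunc.const S (-1 : ℝ) = -SimpleFunc.const S 1 := by ext; simp
      rw [hJ.add_const, h2, map_neg] at h1
      linarith
    · have h1 := hsup (SimpleFunc.const S 1)
      rw [hJ.add_const] at h1
      linarith
  obtain ⟨p, hp⟩ := FinProb.exists_integral_eq L hpos hone
  refine ⟨p, fun ψ => ?_⟩
  have h1 := hsup (ψ - φ)
  rw [add_sub_cancel, map_sub] at h1
  rw [hp, hp]
  linarith

theorem conjugate_eq_of_supergradient {φ : SimpleFunc S ℝ}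
    {p : FinProb S} (h : ∀ ψ, J ψ - p.integral ψ ≤ J φ - p.integral φ) :
    conjugate J p = ENNReal.ofReal (J φ - p.integral φ) :=
  le_antisymm (iSup_le fun ψ => ENNReal.ofReal_le_ofReal (h ψ))
    (le_iSup (fun φ => ENNReal.ofReal (J φ - p.integral φ)) φ)

theorem integral_zero (p : FinProb S) : p.integral 0 = 0 := map_zero p.integralLM

/-- The conjugate is a supremum of continuous functions, and it vanishes at a supergradient of `J`
at `0`. -/
theorem isPenalty_conjugate [Nonempty S] (hJ : IsConcaveNiveloid J) :
    IsPenalty (conjugate J) where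
  lsc := lowerSemicontinuous_iSup fun φ => Continuous.lowerSemicontinuous
    (ENNReal.continuous_ofReal.comp (continuous_const.sub (FinProb.continuous_integral φ)))
  exists_zero := by
    obtain ⟨p, hp⟩ := hJ.exists_supergradient 0
    exact ⟨p, by rw [conjugate_eq_of_supergradient hp, hJ.zero, integral_zero]; simp⟩

/-- A supergradient at `φ` attains the minimum. Truncation by `ENNReal.ofReal` is harmless there:
comparison with the zero function shows `J φ - ∫ φ dp ≥ 0`. -/
theorem penalized_conjugate [Nonempty S] (hJ : IsConcaveNiveloid J) :
    penalized (conjugate J) = J := by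
  ext φ
  apply le_antisymm
  · obtain ⟨p, hp⟩ := hJ.exists_supergradient φ
    have e := conjugate_eq_of_supergradient hp
    have h0 := hp 0
    rw [hJ.zero, integral_zero, sub_zero] at h0
    have := hJ.isPenalty_conjugate.penalized_le φ (p := p) (by rw [e]; exact ENNReal.ofReal_ne_top)
    rw [e, ENNReal.toReal_ofReal h0] at this
    linarith
  · obtain ⟨p, hp, e⟩ := hJ.isPenalty_conjugate.exists_penalized_eq φ
    rw [e]
    have : J φ - p.integral φ ≤ (conjugate J p).toReal := by
      rw [← ENNReal.ofReal_le_iff_le_toReal hp]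
      exact le_iSup (fun φ => ENNReal.ofReal (J φ - p.integral φ)) φ
    linarith

end IsConcaveNiveloid

theorem conjugate_eq_zero_iff {J : SimpleFunc S ℝ → ℝ} {p : FinProb S} :
    conjugate J p = 0 ↔ ∀ φ, J φ ≤ p.integral φ := by
  simp [conjugate, ENNReal.iSup_eq_zero]

theorem ConvexFn.ne_top {k : FinProb S → ℝ≥0∞} (hk : ConvexFn k) {p p' : FinProb S}
    (hp : k p ≠ ∞) (hp' : k p' ≠ ∞) (α : I) : k (FinProb.mix α p p') ≠ ∞ :=
  ne_top_of_le_ne_top (ENNReal.add_ne_top.2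
    ⟨ENNReal.mul_ne_top ENNReal.ofReal_ne_top hp, ENNReal.mul_ne_top ENNReal.ofReal_ne_top hp'⟩)
    (hk p p' α)

theorem ConvexFn.toReal_le {k : FinProb S → ℝ≥0∞} (hk : ConvexFn k) {p p' : FinProb S}
    (hp : k p ≠ ∞) (hp' : k p' ≠ ∞) (α : I) : (k (FinProb.mix α p p')).toReal ≤
      (α : ℝ) * (k p).toReal + (1 - (α : ℝ)) * (k p').toReal := by
  have h1 := ENNReal.mul_ne_top (ENNReal.ofReal_ne_top (r := (α : ℝ))) hp
  have h2 := ENNReal.mul_ne_top (ENNReal.ofReal_ne_top (r := 1 - (α : ℝ))) hp'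
  have h := ENNReal.toReal_mono (ENNReal.add_ne_top.2 ⟨h1, h2⟩) (hk p p' α)
  rwa [ENNReal.toReal_add h1 h2, ENNReal.toReal_mul, ENNReal.toReal_mul,
    ENNReal.toReal_ofReal α.2.1, ENNReal.toReal_ofReal (sub_nonneg.2 α.2.2)] at h

/-- The separation step of the Fenchel-Moreau theorem. -/
theorem IsPenalty.exists_separating {k : FinProb S → ℝ≥0∞} (hk : IsPenalty k)
    (hc : ConvexFn k) {p₀ : FinProb S} {r : ℝ} (hr : 0 ≤ r) (h : ENNReal.ofReal r < k p₀) :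
    ∃ φ : SimpleFunc S ℝ, ∀ p, k p ≠ ∞ →
      r ≤ p.integral φ - p₀.integral φ + (k p).toReal := by
  classical
  -- By lower semicontinuity `k > r` on a weak* neighbourhood of `p₀`, which involves only finitely
  -- many simple functions `F`. Separation thus takes place in `ℝ^F × ℝ`, between an open box below
  -- height `r` and the projected epigraph of `k`.
  obtain ⟨U, hU, hUk⟩ := isOpen_induced_iff.1 (hk.lsc.isOpen_preimage (ENNReal.ofReal r))
  have hp₀ : (fun φ => p₀.integral φ) ∈ U := by
    have : p₀ ∈ k ⁻¹' Ioi (ENNReal.ofReal r) := h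
    rwa [← hUk] at this
  obtain ⟨F, V, hV, hFV⟩ := isOpen_pi_iff.1 hU _ hp₀
  have hball : ∀ a : F, ∃ ε > 0, Metric.ball (p₀.integral a.1) ε ⊆ V a.1 := fun a =>
    Metric.isOpen_iff.1 (hV a.1 a.2).1 _ (hV a.1 a.2).2
  choose ε hε hεV using hball
  let T : FinProb S → F → ℝ := fun p a => p.integral a.1
  let D : Set ((F → ℝ) × ℝ) :=
    (Set.univ.pi fun a => Metric.ball (p₀.integral a.1) (ε a)) ×ˢ Iio r
  let C : Set ((F → ℝ) × ℝ) := {z | ∃ p, k p ≠ ∞ ∧ z.1 = T p ∧ (k p).toReal ≤ z.2}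
  have hD1 : Convex ℝ D := (convex_pi fun a _ => convex_ball _ _).prod (convex_Iio r)
  have hD2 : IsOpen D :=
    (isOpen_set_pi finite_univ fun a _ => Metric.isOpen_ball).prod isOpen_Iio
  have hC : Convex ℝ C := by
    rintro ⟨_, t⟩ ⟨p, hp, rfl, ht⟩ ⟨_, t'⟩ ⟨p', hp', rfl, ht'⟩ a b ha hb hab
    obtain rfl : b = 1 - a := by linarith
    have ha' : a ∈ I := ⟨ha, by linarith⟩
    refine ⟨FinProb.mix ⟨a, ha'⟩ p p', hc.ne_top hp hp' _, ?_, ?_⟩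
    · funext i
      simp [T, FinProb.integral_mix]
    · refine (hc.toReal_le hp hp' _).trans ?_
      simp only at ht ht'
      simp only [Prod.snd_add, Prod.smul_snd, smul_eq_mul]
      gcongr
  have hdisj : Disjoint D C := by
    rw [Set.disjoint_left]
    rintro ⟨_, t⟩ ⟨hz, ht : t < r⟩ ⟨p, hp, rfl, ht' : (k p).toReal ≤ t⟩
    have hmem : (fun φ => p.integral φ) ∈ U :=
      hFV fun a ha => hεV ⟨a, ha⟩ (hz ⟨a, ha⟩ (mem_univ _))
    have hlt : ENNReal.ofReal r < k p := by
      have : p ∈ (fun (p : FinProb S) (φ : SimpleFunc S ℝ) => p.integral φ) ⁻¹' U := hmem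
      rwa [hUk] at this
    have := (ENNReal.ofReal_lt_iff_lt_toReal hr hp).1 hlt
    linarith
  obtain ⟨f, s, hfD, hfC⟩ := geometric_hahn_banach_open hD1 hD2 hC hdisj
  -- In coordinates, the separating functional is `∫ ψ dp + b * t`.
  let ψ : SimpleFunc S ℝ := ∑ a : F, f (Pi.single a 1, 0) • a.1
  let b : ℝ := f (0, 1)
  have hf : ∀ (p : FinProb S) (t : ℝ), f (T p, t) = p.integral ψ + b * t := by
    intro p t
    have h1 : (T p, t) = (T p, (0 : ℝ)) + t • ((0 : F → ℝ), (1 : ℝ)) := by simp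
    have h2 : f (T p, (0 : ℝ)) = p.integral ψ := by
      have h3 := LinearMap.pi_apply_eq_sum_univ
        (f.toLinearMap.comp (LinearMap.inl ℝ (F → ℝ) ℝ)) (T p)
      have h4 : p.integral ψ = ∑ a : F, f (Pi.single a 1, 0) * p.integral a.1 := by
        rw [← FinProb.integralLM_apply, map_sum]
        simp only [map_smul, smul_eq_mul, FinProb.integralLM_apply]
      rw [h4]
      refine h3.trans (Finset.sum_congr rfl fun a _ => ?_)
      have h5 : (fun j : F => if a = j then (1 : ℝ) else 0) = Pi.single a 1 := by
        funext j
        simp [Pi.single_apply, eq_comm]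
      rw [smul_eq_mul, mul_comm, ← h5]
      rfl
    rw [h1, map_add, map_smul, h2, smul_eq_mul, mul_comm]
  have hlow : ∀ t < r, p₀.integral ψ + b * t < s := fun t ht => by
    rw [← hf]
    exact hfD _ ⟨fun a _ => Metric.mem_ball_self (hε a), ht⟩
  have hup : ∀ p, k p ≠ ∞ → s ≤ p.integral ψ + b * (k p).toReal := fun p hp => by
    rw [← hf]
    exact hfC _ ⟨p, hp, rfl, le_rfl⟩
  -- The box contains arbitrarily low heights, on which a negative `b` would push the functional
  -- above `s`.
  have hb : 0 ≤ b := by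
    by_contra! hb
    have h1 := hlow (min (r - 1) ((s - p₀.integral ψ) / b)) ((min_le_left _ _).trans_lt (by linarith))
    have h2 : b * ((s - p₀.integral ψ) / b) ≤ b * min (r - 1) ((s - p₀.integral ψ) / b) :=
      mul_le_mul_of_nonpos_left (min_le_right _ _) hb.le
    rw [mul_div_cancel₀ _ hb.ne] at h2
    linarith
  -- If `b = 0` the hyperplane is vertical: `ψ` is rescaled so that its gap at `p₀` becomes `r`, and
  -- `k ≥ 0` does the rest. If `b > 0`, division by `b` suffices.
  rcases hb.eq_or_lt with hb0 | hb0
  · have hlt : p₀.integral ψ < s := by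
      have := hlow (r - 1) (by linarith)
      rwa [← hb0, zero_mul, add_zero] at this
    refine ⟨(r / (s - p₀.integral ψ)) • ψ, fun p hp => ?_⟩
    have h1 := hup p hp
    rw [← hb0, zero_mul, add_zero] at h1
    rw [FinProb.integral_smul, FinProb.integral_smul, ← mul_sub]
    have h2 : r = r / (s - p₀.integral ψ) * (s - p₀.integral ψ) := by
      rw [div_mul_cancel₀ _ (sub_pos.2 hlt).ne']
    have h3 : r / (s - p₀.integral ψ) * (s - p₀.integral ψ) ≤
        r / (s - p₀.integral ψ) * (p.integral ψ - p₀.integral ψ) :=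
      mul_le_mul_of_nonneg_left (by linarith) (div_nonneg hr (sub_pos.2 hlt).le)
    linarith [ENNReal.toReal_nonneg (a := k p)]
  · have hle : p₀.integral ψ + b * r ≤ s := by
      refine le_of_forall_pos_le_add fun δ hδ => ?_
      have := hlow (r - δ / b) (by linarith [div_pos hδ hb0])
      rw [mul_sub, mul_div_cancel₀ _ hb0.ne'] at this
      linarith
    refine ⟨b⁻¹ • ψ, fun p hp => ?_⟩
    have h1 := hup p hp
    rw [FinProb.integral_smul, FinProb.integral_smul]
    have h2 : b * r ≤ b * (b⁻¹ * p.integral ψ - b⁻¹ * p₀.integral ψ + (k p).toReal) := by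
      have : b * (b⁻¹ * p.integral ψ - b⁻¹ * p₀.integral ψ + (k p).toReal) =
        p.integral ψ - p₀.integral ψ + b * (k p).toReal := by field_simp
      linarith
    exact le_of_mul_le_mul_left h2 hb0

/-- Convex penalties are recovered from the functionals they define. -/
theorem IsPenalty.conjugate_penalized [Nonempty S] {k : FinProb S → ℝ≥0∞} (hk : IsPenalty k)
    (hc : ConvexFn k) : conjugate (penalized k) = k := by
  ext p₀
  apply le_antisymm
  · refine iSup_le fun φ => ?_
    by_cases hp : k p₀ = ∞
    · simp [hp]
    · rw [ENNReal.ofReal_le_iff_le_toReal hp]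
      linarith [hk.penalized_le φ hp]
  · refine le_of_forall_lt fun r hr => ?_
    -- A finite level strictly below `k p₀` also covers the case `k p₀ = ∞`.
    obtain ⟨r', hrr', hr'⟩ := exists_between hr
    lift r' to NNReal using hr'.ne_top
    obtain ⟨φ, hφ⟩ := hk.exists_separating hc (r := r') r'.2 (by simpa using hr')
    refine hrr'.trans_le (le_trans ?_ (le_iSup (fun φ => ENNReal.ofReal
      (penalized k φ - p₀.integral φ)) φ))
    obtain ⟨p, hp, e⟩ := hk.exists_penalized_eq φ
    rw [← ENNReal.ofReal_coe_nnreal]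
    refine ENNReal.ofReal_le_ofReal ?_
    linarith [hφ p hp]

end Penalties

end Misspec

namespace Misspec

/-! ### Mixture orders and affine utilities on consequences. -/

section Consequences

variable {E : Type*} [AddCommGroup E] [Module ℝ E] {X : Set E}

theorem coe_mixX (hX : Convex ℝ X) (α : I) (x y : X) :
    (mixX hX α x y : E) = (α : ℝ) • (x : E) + (1 - (α : ℝ)) • (y : E) := rfl

theorem exists_mix (hX : Convex ℝ X) (x y : X) {t : ℝ} (h0 : 0 ≤ t) (h1 : t ≤ 1) :
    ∃ a : X, (a : E) = t • (x : E) + (1 - t) • (y : E) :=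
  ⟨mixX hX ⟨t, h0, h1⟩ x y, rfl⟩

/-- Weak orders on consequences that are continuous, convex, and whose ranking of mixtures with a
common consequence does not depend on that consequence. -/
structure IsMixtureOrder (hX : Convex ℝ X) (r : X → X → Prop) : Prop where
  refl : ∀ x, r x x
  trans : ∀ x y z, r x y → r y z → r x z
  total : ∀ x y, r x y ∨ r y x
  weak_indep : ∀ (x y z w : X) (α : I), 0 < α → α < 1 →
    r (mixX hX α x z) (mixX hX α y z) → r (mixX hX α x w) (mixX hX α y w)
  convex : ∀ (x y z : X) (α : I), 0 < α → α < 1 → r x z → r y z → r (mixX hX α x y) z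
  closed_left : ∀ x y z, IsClosed {α : I | r (mixX hX α x y) z}
  closed_right : ∀ x y z, IsClosed {α : I | r z (mixX hX α x y)}

namespace IsMixtureOrder

variable {hX : Convex ℝ X} {r : X → X → Prop}

/-- Convexity ranks `t x + (1 - t) y` above `y = t y + (1 - t) y`; weak independence then replaces
the common `y` by `z`. -/
theorem mixture_of_rel (hr : IsMixtureOrder hX r) {x y : X} (h : r x y) {t : ℝ} (h0 : 0 < t)
    (h1 : t < 1) {z a b : X} (ha : (a : E) = t • (x : E) + (1 - t) • (z : E))
    (hb : (b : E) = t • (y : E) + (1 - t) • (z : E)) : r a b := by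
  have h2 := hr.convex x y y ⟨t, h0.le, h1.le⟩ h0 h1 h (hr.refl y)
  have h3 : mixX hX ⟨t, h0.le, h1.le⟩ y y = y := Subtype.ext (by rw [coe_mixX]; module)
  have h4 := hr.weak_indep x y y z ⟨t, h0.le, h1.le⟩ h0 h1 (by rwa [h3])
  rwa [show a = mixX hX ⟨t, h0.le, h1.le⟩ x z from Subtype.ext ha,
    show b = mixX hX ⟨t, h0.le, h1.le⟩ y z from Subtype.ext hb]

theorem antitone_segment (hr : IsMixtureOrder hX r) {x y : X} (h : r y x) {ν ν' : ℝ}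
    (h0 : 0 ≤ ν) (h1 : ν' ≤ 1) (hν : ν ≤ ν') {a b : X}
    (ha : (a : E) = ν • (x : E) + (1 - ν) • (y : E))
    (hb : (b : E) = ν' • (x : E) + (1 - ν') • (y : E)) : r a b := by
  rcases hν.eq_or_lt with rfl | hlt
  · rw [show a = b from Subtype.ext (ha.trans hb.symm)]
    exact hr.refl b
  by_cases hs : ν' - ν < 1
  · have hpos : 0 < 1 - (ν' - ν) := by linarith
    -- With this `z`, `a` and `b` arise from `y` and `x` by mixing with weight `ν' - ν` into the
    -- same `z`.
    obtain ⟨z, hz⟩ := exists_mix hX x y (t := ν / (1 - (ν' - ν))) (by positivity)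
      ((div_le_one hpos).2 (by linarith))
    refine hr.mixture_of_rel h (t := ν' - ν) (by linarith) hs (z := z) ?_ ?_
    · rw [ha, hz]
      match_scalars <;> field_simp
      ring
    · rw [hb, hz]
      match_scalars <;> field_simp <;> ring
  · obtain rfl : ν = 0 := by linarith
    obtain rfl : ν' = 1 := by linarith
    rwa [show a = y from Subtype.ext (by rw [ha]; module),
      show b = x from Subtype.ext (by rw [hb]; module)]

/-- If the ranking failed, then `y` would be weakly better than `x`. By weak independence, moving by
`t` along the segment from `y` towards `x` never hurts, so finitely many moves give `r x y` after
all. -/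
theorem rel_of_mixture (hr : IsMixtureOrder hX r) {x y : X} {t : ℝ} (h0 : 0 < t)
    (h1 : t < 1) {z a b : X} (ha : (a : E) = t • (x : E) + (1 - t) • (z : E))
    (hb : (b : E) = t • (y : E) + (1 - t) • (z : E)) (h : r a b) : r x y := by
  by_contra hn
  have hyx : r y x := (hr.total x y).resolve_left hn
  have hD : ∀ z a b : X, (a : E) = t • (x : E) + (1 - t) • (z : E) →
      (b : E) = t • (y : E) + (1 - t) • (z : E) → r a b := by
    intro w c d hc hd
    rw [show c = mixX hX ⟨t, h0.le, h1.le⟩ x w from Subtype.ext hc,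
      show d = mixX hX ⟨t, h0.le, h1.le⟩ y w from Subtype.ext hd]
    refine hr.weak_indep x y z w ⟨t, h0.le, h1.le⟩ h0 h1 ?_
    rwa [show a = mixX hX ⟨t, h0.le, h1.le⟩ x z from Subtype.ext ha,
      show b = mixX hX ⟨t, h0.le, h1.le⟩ y z from Subtype.ext hb] at h
  have hchain : ∀ n : ℕ, ∀ ν : ℝ, 0 ≤ ν → ν ≤ 1 → ν ≤ n * t → ∀ c : X,
      (c : E) = ν • (x : E) + (1 - ν) • (y : E) → r c y := by
    intro n
    induction n with
    | zero =>
      intro ν hν0 _ hν c hc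
      obtain rfl : ν = 0 := le_antisymm (by simpa using hν) hν0
      rw [show c = y from Subtype.ext (by rw [hc]; module)]
      exact hr.refl y
    | succ n ih =>
      intro ν hν0 hν1 hν c hc
      push_cast at hν
      by_cases hlt : ν < t
      -- A remainder shorter than `t` is rounded up to `t`, which is no better by
      -- `antitone_segment`.
      · obtain ⟨d, hd⟩ := exists_mix hX x y h0.le h1.le
        exact hr.trans _ _ _ (hr.antitone_segment hyx hν0 h1.le hlt.le hc hd)
          (hD y d y hd (by module))
      · push Not at hlt
        obtain ⟨d, hd⟩ := exists_mix hX x y (t := ν - t) (by linarith) (by linarith)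
        have hpos : 0 < 1 - t := by linarith
        obtain ⟨w, hw⟩ := exists_mix hX x y (t := (ν - t) / (1 - t))
          (div_nonneg (by linarith) hpos.le) ((div_le_one hpos).2 (by linarith))
        refine hr.trans _ _ _ (hD w c d ?_ ?_) (ih (ν - t) (by linarith) (by linarith)
          (by linarith) d hd)
        · rw [hc, hw]
          match_scalars <;> field_simp <;> ring
        · rw [hd, hw]
          match_scalars <;> field_simp
          ring
  obtain ⟨n, hn'⟩ := exists_nat_ge (1 / t)
  exact hn (hchain n 1 zero_le_one le_rfl ((div_le_iff₀ h0).1 hn') x (by module))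

/-- The ranking depends only on the direction of the difference: `a + t y = b + t x`, so after
division by `1 + t` the same two points are mixtures of `a`, `b` with `y` and of `x`, `y` with `b`.
-/
theorem rel_iff_of_sub_eq_smul (hr : IsMixtureOrder hX r) {x y a b : X} {t : ℝ} (ht : 0 < t)
    (h : (a : E) - b = t • ((x : E) - y)) : r x y ↔ r a b := by
  have h0 : 0 < 1 / (1 + t) := by positivity
  have h1 : 1 / (1 + t) < 1 := (div_lt_one (by linarith)).2 (by linarith)
  have h0' : 0 < 1 - 1 / (1 + t) := by linarith
  obtain ⟨m, hm⟩ := exists_mix hX a y h0.le h1.le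
  obtain ⟨m', hm'⟩ := exists_mix hX b y h0.le h1.le
  have e : (m : E) = (1 - 1 / (1 + t)) • (x : E) + (1 - (1 - 1 / (1 + t))) • (b : E) := by
    have ha : (a : E) = b + t • ((x : E) - y) := by rw [← h]; abel
    rw [hm, ha]
    match_scalars <;> field_simp <;> ring
  have e' : (m' : E) = (1 - 1 / (1 + t)) • (y : E) + (1 - (1 - 1 / (1 + t))) • (b : E) := by
    rw [hm']
    module
  exact ⟨fun hxy => hr.rel_of_mixture h0 h1 hm hm'
      (hr.mixture_of_rel hxy h0' (by linarith) e e'),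
    fun hab => hr.rel_of_mixture h0' (by linarith) e e'
      (hr.mixture_of_rel hab h0 h1 hm hm')⟩

/-- The cone generated by the differences `x - y` with `x` weakly preferred to `y`. -/
def PrefCone (r : X → X → Prop) (v : E) : Prop :=
  ∃ (t : ℝ) (x y : X), 0 < t ∧ v = t • ((x : E) - y) ∧ r x y

theorem prefCone_sub_iff (hr : IsMixtureOrder hX r) {x y : X} :
    PrefCone r ((x : E) - y) ↔ r x y := by
  constructor
  · rintro ⟨t, a, b, ht, e, hab⟩
    exact (hr.rel_iff_of_sub_eq_smul ht e).1 hab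
  · exact fun h => ⟨1, x, y, one_pos, (one_smul _ _).symm, h⟩

theorem prefCone_smul {v : E} (h : PrefCone r v) {c : ℝ} (hc : 0 < c) : PrefCone r (c • v) := by
  obtain ⟨t, x, y, ht, rfl, hxy⟩ := h
  exact ⟨c * t, x, y, mul_pos hc ht, by rw [mul_smul], hxy⟩

/-- Up to the factor `t + s`, the sum is the difference of a mixture of `x, x'` and one of `y, y'`,
compared through the mixture `b` of `y, x'`. -/
theorem prefCone_add (hr : IsMixtureOrder hX r) {v w : E} (hv : PrefCone r v)
    (hw : PrefCone r w) : PrefCone r (v + w) := by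
  obtain ⟨t, x, y, ht, rfl, hxy⟩ := hv
  obtain ⟨s, x', y', hs, rfl, hxy'⟩ := hw
  have hts : 0 < t + s := add_pos ht hs
  have h0 : 0 < t / (t + s) := by positivity
  have h1 : t / (t + s) < 1 := (div_lt_one hts).2 (by linarith)
  obtain ⟨a, ha⟩ := exists_mix hX x x' h0.le h1.le
  obtain ⟨b, hb⟩ := exists_mix hX y x' h0.le h1.le
  obtain ⟨c, hc⟩ := exists_mix hX y y' h0.le h1.le
  refine ⟨t + s, a, c, hts, ?_, hr.trans _ b _ (hr.mixture_of_rel hxy h0 h1 ha hb)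
    (hr.mixture_of_rel hxy' (t := 1 - t / (t + s)) (by linarith) (by linarith) (z := y) ?_ ?_)⟩
  · rw [ha, hc]
    match_scalars <;> field_simp
    all_goals ring
  · rw [hb]; module
  · rw [hc]; module

/-- The vectors that are neutral for the preference. -/
def Neutral (r : X → X → Prop) (v : E) : Prop := PrefCone r v ∧ PrefCone r (-v)

theorem neutral_add (hr : IsMixtureOrder hX r) {v w : E} (hv : Neutral r v) (hw : Neutral r w) :
    Neutral r (v + w) :=
  ⟨hr.prefCone_add hv.1 hw.1, by rw [neg_add]; exact hr.prefCone_add hv.2 hw.2⟩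

theorem neutral_smul (hr : IsMixtureOrder hX r) [Nonempty X] {v : E} (hv : Neutral r v) (c : ℝ) :
    Neutral r (c • v) := by
  rcases lt_trichotomy c 0 with hc | rfl | hc
  · refine ⟨?_, ?_⟩
    · rw [← neg_smul_neg]; exact prefCone_smul hv.2 (neg_pos.2 hc)
    · rw [← neg_smul]; exact prefCone_smul hv.1 (neg_pos.2 hc)
  · have h := hr.prefCone_sub_iff.2 (hr.refl (Classical.arbitrary X))
    rw [sub_self] at h
    simpa [Neutral] using h
  · exact ⟨prefCone_smul hv.1 hc, by rw [← smul_neg]; exact prefCone_smul hv.2 hc⟩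

theorem neutral_sub_iff (hr : IsMixtureOrder hX r) {x y : X} :
    Neutral r ((x : E) - y) ↔ r x y ∧ r y x := by
  rw [Neutral, neg_sub, hr.prefCone_sub_iff, hr.prefCone_sub_iff]

/-- Two closed sets cover the connected unit interval, so they meet. -/
theorem exists_indiff (hr : IsMixtureOrder hX r) {x y z : X} (hxz : r x z) (hzy : r z y) :
    ∃ α : I, r (mixX hX α x y) z ∧ r z (mixX hX α x y) := by
  have h := isPreconnected_closed_iff.1 (isPreconnected_univ (α := I)) _ _
    (hr.closed_left x y z) (hr.closed_right x y z) (fun α _ => hr.total _ _)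
    ⟨1, mem_univ _, by
      have : mixX hX 1 x y = x := Subtype.ext (by rw [coe_mixX]; simp)
      simpa [this] using hxz⟩
    ⟨0, mem_univ _, by
      have : mixX hX 0 x y = y := Subtype.ext (by rw [coe_mixX]; simp)
      simpa [this] using hzy⟩
  obtain ⟨α, -, h1, h2⟩ := h
  exact ⟨α, h1, h2⟩

/-- Modulo neutral vectors there is one dimension. Of `x₀`, `y₀`, `z`, the middle one is indifferent
to a mixture of the other two; solving for `z` divides by a weight that is nonzero because `x₀` is
strictly better than `y₀`. -/
theorem exists_coordinate (hr : IsMixtureOrder hX r) {x₀ y₀ : X} (h : r x₀ y₀)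
    (hn : ¬ r y₀ x₀) (z : X) : ∃ t : ℝ, Neutral r ((z : E) - y₀ - t • ((x₀ : E) - y₀)) := by
  have : Nonempty X := ⟨z⟩
  rcases hr.total x₀ z with h1 | h1
  · rcases hr.total z y₀ with h2 | h2
    · obtain ⟨α, ha, hb⟩ := hr.exists_indiff h1 h2
      refine ⟨α, ?_⟩
      have := hr.neutral_sub_iff.2 ⟨hb, ha⟩
      rw [coe_mixX] at this
      convert this using 1
      module
    · obtain ⟨α, ha, hb⟩ := hr.exists_indiff h h2
      have hα : 1 - (α : ℝ) ≠ 0 := by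
        intro h0
        have : mixX hX α x₀ z = x₀ := Subtype.ext (by
          rw [coe_mixX, h0, show (α : ℝ) = 1 by linarith]; simp)
        rw [this] at hb
        exact hn hb
      have := hr.neutral_smul (hr.neutral_sub_iff.2 ⟨hb, ha⟩) (-(1 - (α : ℝ))⁻¹)
      refine ⟨-((α : ℝ) / (1 - (α : ℝ))), ?_⟩
      rw [coe_mixX] at this
      convert this using 1
      match_scalars <;> field_simp
      ring
  · obtain ⟨α, ha, hb⟩ := hr.exists_indiff h1 h
    have hα : (α : ℝ) ≠ 0 := by
      intro h0
      have : mixX hX α z y₀ = y₀ := Subtype.ext (by rw [coe_mixX, h0]; simp)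
      rw [this] at ha
      exact hn ha
    have := hr.neutral_smul (hr.neutral_sub_iff.2 ⟨hb, ha⟩) (-(α : ℝ)⁻¹)
    refine ⟨(α : ℝ)⁻¹, ?_⟩
    rw [coe_mixX] at this
    convert this using 1
    match_scalars <;> field_simp
    ring

/-- The mixture space theorem. -/
theorem exists_affine_utility (hr : IsMixtureOrder hX r) (hnt : ∃ x y, r x y ∧ ¬ r y x) :
    ∃ u : X → ℝ, IsAffine hX u ∧ ∀ x y, r x y ↔ u y ≤ u x := by
  obtain ⟨x₀, y₀, h, hn⟩ := hnt
  have : Nonempty X := ⟨x₀⟩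
  choose u hu using hr.exists_coordinate h hn
  have hd : PrefCone r ((x₀ : E) - y₀) := hr.prefCone_sub_iff.2 h
  -- Coordinates are unique because `x₀ - y₀` is not neutral; affinity follows.
  have hunique : ∀ s : ℝ, Neutral r (s • ((x₀ : E) - y₀)) → s = 0 := by
    intro s hs
    by_contra hs0
    have := hr.neutral_smul hs s⁻¹
    rw [smul_smul, inv_mul_cancel₀ hs0, one_smul] at this
    exact hn (hr.neutral_sub_iff.1 this).2
  have hdiff : ∀ x y : X, Neutral r ((x : E) - y - (u x - u y) • ((x₀ : E) - y₀)) := by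
    intro x y
    have := hr.neutral_add (hu x) (hr.neutral_smul (hu y) (-1))
    convert this using 1
    module
  have hle : ∀ x y, u y ≤ u x → r x y := by
    intro x y hxy
    rw [← hr.prefCone_sub_iff]
    rcases hxy.eq_or_lt with e | hlt
    · have := (hdiff x y).1
      rwa [e, sub_self, zero_smul, sub_zero] at this
    · have := hr.prefCone_add (hdiff x y).1 (prefCone_smul hd (sub_pos.2 hlt))
      rwa [sub_add_cancel] at this
  refine ⟨u, fun α x y => ?_, fun x y => ⟨fun hxy => ?_, hle x y⟩⟩
  · have h1 := hr.neutral_add (hr.neutral_smul (hu (mixX hX α x y)) (-1))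
      (hr.neutral_add (hr.neutral_smul (hu x) α) (hr.neutral_smul (hu y) (1 - (α : ℝ))))
    have h2 := hunique (u (mixX hX α x y) - ((α : ℝ) * u x + (1 - (α : ℝ)) * u y)) (by
      convert h1 using 1
      rw [coe_mixX]
      module)
    linarith
  · by_contra hlt
    push Not at hlt
    have h1 := hr.neutral_add (hr.neutral_smul (hdiff x y) (-1))
      (hr.neutral_sub_iff.2 ⟨hxy, hle y x hlt.le⟩)
    have h2 := hunique (u x - u y) (by
      convert h1 using 1
      module)
    linarith

end IsMixtureOrder

/-- The constants are read off at `u = 0` and `u = 1`. For any third consequence, the middle one of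
the three is indifferent to a mixture of the others, and `v` is evaluated on both sides. -/
theorem affine_utility_unique {hX : Convex ℝ X} {u v : X → ℝ} (hu : IsAffine hX u)
    (hv : IsAffine hX v) (hsurj : Function.Surjective u)
    (h : ∀ x y, u y ≤ u x ↔ v y ≤ v x) : ∃ a b : ℝ, 0 < a ∧ ∀ x, v x = a * u x + b := by
  have heq : ∀ x y, u x = u y → v x = v y := fun x y e =>
    le_antisymm ((h y x).1 e.le) ((h x y).1 e.ge)
  obtain ⟨x₀, h₀⟩ := hsurj 0
  obtain ⟨x₁, h₁⟩ := hsurj 1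
  refine ⟨v x₁ - v x₀, v x₀, ?_, fun x => ?_⟩
  · by_contra! hle
    have := (h x₀ x₁).2 (by linarith)
    rw [h₀, h₁] at this
    linarith
  · rcases le_or_gt (u x) 1 with hx1 | hx1
    · rcases le_or_gt 0 (u x) with hx0 | hx0
      · have e := heq x (mixX hX ⟨u x, hx0, hx1⟩ x₁ x₀) (by rw [hu, h₀, h₁]; simp)
        rw [e, hv]
        simp only
        ring
      · have hpos : 0 < 1 - u x := by linarith
        have e := heq x₀ (mixX hX ⟨-u x / (1 - u x), div_nonneg (by linarith) hpos.le,
          (div_le_one hpos).2 (by linarith)⟩ x₁ x) (by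
            rw [hu, h₀, h₁]; field_simp; ring)
        rw [hv] at e
        simp only at e
        field_simp at e
        linarith
    · have hpos : 0 < u x := by linarith
      have e := heq x₁ (mixX hX ⟨(u x)⁻¹, (inv_pos.2 hpos).le, inv_le_one_of_one_le₀ hx1.le⟩ x x₀)
        (by rw [hu, h₀, h₁]; simp [hpos.ne'])
      rw [hv] at e
      simp only at e
      field_simp at e
      linarith

/-- A coarsening that ties two distinct utility levels can, by mixing and surjectivity, reproduce
half that gap at every level; chaining the ties would make the relation trivial. -/
theorem utility_represents_coarsening {hX : Convex ℝ X} {u : X → ℝ} (hu : IsAffine hX u)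
    (hsurj : Function.Surjective u) {r : X → X → Prop} (htrans : ∀ x y z, r x y → r y z → r x z)
    (hle : ∀ x y, u y ≤ u x → r x y) (hnt : ∃ x y, r x y ∧ ¬ r y x)
    (hindep : ∀ x y z, r x y → r y x → r (mixX hX oneHalf x z) (mixX hX oneHalf y z)) (x y : X) :
    r x y ↔ u y ≤ u x := by
  refine ⟨fun hxy => ?_, hle x y⟩
  by_contra hlt
  push Not at hlt
  have hyx := hle y x hlt.le
  have hstep : ∀ a b, u b ≤ u a + (u y - u x) / 2 → r a b := by
    intro a b hab
    -- The half mixtures of `x` and `y` with this `z` have utilities `u a` and `u a + (u y - u x) /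
    -- 2`.
    obtain ⟨z, hz⟩ := hsurj (2 * u a - u x)
    refine htrans _ _ _ (hle a (mixX hX oneHalf x z) ?_) (htrans _ _ _ (hindep x y z hxy hyx)
      (hle _ b ?_))
    · rw [hu, hz]; simp only [oneHalf]; linarith
    · rw [hu, hz]; simp only [oneHalf]; linarith
  have hchain : ∀ n : ℕ, ∀ a b, u b ≤ u a + n * ((u y - u x) / 2) → r a b := by
    intro n
    induction n with
    | zero => exact fun a b hab => hle a b (by simpa using hab)
    | succ n ih =>
      intro a b hab
      push_cast at hab
      obtain ⟨c, hc⟩ := hsurj (u a + n * ((u y - u x) / 2))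
      exact htrans _ _ _ (ih a c hc.le) (hstep c b (by rw [hc]; linarith))
  obtain ⟨a, b, -, hba⟩ := hnt
  obtain ⟨n, hn⟩ := exists_nat_ge ((u a - u b) / ((u y - u x) / 2))
  refine hba (hchain n b a ?_)
  rw [div_le_iff₀ (by linarith)] at hn
  linarith

/-- Each use of unboundedness doubles a utility gap, upwards or downwards; mixing fills in the
values between. -/
theorem affine_utility_surjective {hX : Convex ℝ X} {u : X → ℝ} (hu : IsAffine hX u)
    (hnt : ∃ x y, u y < u x)
    (hunb : ∀ x y, u y < u x → ∃ z z', u x ≤ u (mixX hX oneHalf z y) ∧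
      u (mixX hX oneHalf x z') ≤ u y) : Function.Surjective u := by
  obtain ⟨x₀, y₀, h₀⟩ := hnt
  have hup : ∀ n : ℕ, ∃ x, u y₀ + 2 ^ n * (u x₀ - u y₀) ≤ u x := by
    intro n
    induction n with
    | zero => exact ⟨x₀, by simp⟩
    | succ n ih =>
      obtain ⟨x, hx⟩ := ih
      have : 0 < (2 : ℝ) ^ n * (u x₀ - u y₀) := mul_pos (by positivity) (by linarith)
      obtain ⟨z, -, hz, -⟩ := hunb x y₀ (by linarith)
      rw [hu] at hz
      simp only [oneHalf] at hz
      exact ⟨z, by rw [pow_succ]; linarith⟩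
  have hdown : ∀ n : ℕ, ∃ y, u y ≤ u x₀ - 2 ^ n * (u x₀ - u y₀) := by
    intro n
    induction n with
    | zero => exact ⟨y₀, by simp⟩
    | succ n ih =>
      obtain ⟨y, hy⟩ := ih
      have : 0 < (2 : ℝ) ^ n * (u x₀ - u y₀) := mul_pos (by positivity) (by linarith)
      obtain ⟨-, z, -, hz⟩ := hunb x₀ y (by linarith)
      rw [hu] at hz
      simp only [oneHalf] at hz
      exact ⟨z, by rw [pow_succ]; linarith⟩
  have hpow : ∀ c : ℝ, ∃ n : ℕ, c ≤ 2 ^ n * (u x₀ - u y₀) := by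
    intro c
    obtain ⟨n, hn⟩ := pow_unbounded_of_one_lt (c / (u x₀ - u y₀)) (one_lt_two (α := ℝ))
    exact ⟨n, ((div_lt_iff₀ (by linarith)).1 hn).le⟩
  intro t
  obtain ⟨n, hn⟩ := hpow (t - u y₀)
  obtain ⟨m, hm⟩ := hpow (u x₀ - t)
  obtain ⟨a, ha⟩ := hup n
  obtain ⟨b, hb⟩ := hdown m
  rcases eq_or_lt_of_le (show u b ≤ u a by linarith) with e | hlt
  · exact ⟨a, by linarith⟩
  · have hpos : 0 < u a - u b := by linarith
    refine ⟨mixX hX ⟨(t - u b) / (u a - u b), div_nonneg (by linarith) hpos.le,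
      (div_le_one hpos).2 (by linarith)⟩ a b, ?_⟩
    rw [hu]
    field_simp
    ring

end Consequences

end Misspec

namespace Misspec

/-! ### Acts as utility profiles. -/

section Utility

variable {S : Type*} [MeasurableSpace S] {E : Type*} {X : Set E}

theorem map_constAct (u : X → ℝ) (x : X) :
    (constAct S x).map u = SimpleFunc.const S (u x) := by
  ext s; simp

theorem exists_act_map_eq {u : X → ℝ} (hu : Function.Surjective u) (φ : SimpleFunc S ℝ) :
    ∃ f : Act S X, f.map u = φ :=
  ⟨φ.map (Function.surjInv hu), by ext s; simp [Function.surjInv_eq hu]⟩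

theorem IsPenalty.exists_objective_eq [Nonempty S] {k : FinProb S → ℝ≥0∞} (hk : IsPenalty k)
    (u : X → ℝ) (f : Act S X) : ∃ p, objective u k f p = value u k f ∧
      objective u k f p = (penalized k (f.map u) : ℝ) := by
  have hobj : ∀ p, k p ≠ ∞ →
      objective u k f p = ((p.integral (f.map u) + (k p).toReal : ℝ) : EReal) := by
    intro p hp
    rw [objective, EReal.coe_add]
    congr 1
    lift k p to NNReal using hp with c
    rfl
  obtain ⟨p, hp, e⟩ := hk.exists_penalized_eq (f.map u)
  refine ⟨p, le_antisymm (le_iInf fun p' => ?_) (iInf_le _ p), by rw [hobj p hp, e]⟩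
  by_cases hp' : k p' = ∞
  · simp [objective, hp']
  · rw [hobj p hp, hobj p' hp', EReal.coe_le_coe_iff, ← e]
    exact hk.penalized_le _ hp'

theorem IsPenalty.value_eq [Nonempty S] {k : FinProb S → ℝ≥0∞} (hk : IsPenalty k)
    (u : X → ℝ) (f : Act S X) : value u k f = (penalized k (f.map u) : ℝ) := by
  obtain ⟨p, h1, h2⟩ := hk.exists_objective_eq u f
  rw [← h1, h2]

variable [AddCommGroup E] [Module ℝ E]

theorem map_mixAct {hX : Convex ℝ X} {u : X → ℝ} (hu : IsAffine hX u) (α : I) (f g : Act S X) :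
    (mixAct hX α f g).map u = (α : ℝ) • f.map u + (1 - (α : ℝ)) • g.map u := by
  ext s
  simp [mixAct, hu α (f s) (g s)]

theorem mixAct_const (hX : Convex ℝ X) (α : I) (x y : X) :
    mixAct hX α (constAct S x) (constAct S y) = constAct S (mixX hX α x y) := by
  ext s
  simp [mixAct]

/-- The choice of utility is immaterial, since integration commutes with positive affine maps. -/
theorem mem_modelEquiv_iff [Nonempty S] {hX : Convex ℝ X} {u : X → ℝ} (hu : IsAffine hX u)
    (hsurj : Function.Surjective u) {R : Act S X → Act S X → Prop}
    (hR : ∀ x x', R (constAct S x) (constAct S x') ↔ u x' ≤ u x) (f : Act S X) (p : FinProb S)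
    (y : X) : y ∈ modelEquiv hX R f p ↔ u y = p.integral (f.map u) := by
  constructor
  · rintro ⟨v, hv, hRv, e⟩
    obtain ⟨a, b, ha, hab⟩ := affine_utility_unique hu hv hsurj
      fun x x' => (hR x x').symm.trans (hRv x x')
    have hmap : f.map v = a • f.map u + SimpleFunc.const S b := by
      ext s
      simp [hab]
    rw [hmap, p.integral_add, p.integral_smul, p.integral_const, hab] at e
    exact mul_left_cancel₀ ha.ne' (by linarith)
  · exact fun e => ⟨u, hu, hR, e⟩

/-- Coherence at `p` says that every level above `∫ u(f) dp` exceeds `J (u(f))`; as `u` is onto, the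
levels can decrease to the integral. -/
theorem coherent_at_iff [Nonempty S] {hX : Convex ℝ X} {u : X → ℝ} (hu : IsAffine hX u)
    (hsurj : Function.Surjective u) {Rs R : Act S X → Act S X → Prop}
    {J : SimpleFunc S ℝ → ℝ} (hJ : IsConcaveNiveloid J)
    (hRs : ∀ x x', Rs (constAct S x) (constAct S x') ↔ u x' ≤ u x)
    (hR : ∀ f g, R f g ↔ J (g.map u) ≤ J (f.map u)) (p : FinProb S) :
    (∀ (f : Act S X) (x : X), ∀ y ∈ modelEquiv hX R f p,
      Strict Rs (constAct S x) (constAct S y) → Strict R (constAct S x) f) ↔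
    ∀ φ, J φ ≤ p.integral φ := by
  have hRc : ∀ x x', R (constAct S x) (constAct S x') ↔ u x' ≤ u x := fun x x' => by
    rw [hR, map_constAct, map_constAct, hJ.const, hJ.const]
  simp only [mem_modelEquiv_iff hu hsurj hRc, Strict, hRs, hR, map_constAct, hJ.const]
  constructor
  · intro h φ
    obtain ⟨f, rfl⟩ := exists_act_map_eq (S := S) hsurj φ
    obtain ⟨y, hy⟩ := hsurj (p.integral (f.map u))
    refine le_of_forall_gt fun t ht => ?_
    obtain ⟨x, rfl⟩ := hsurj t
    rw [← hy] at ht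
    exact not_le.1 (h f x y hy ⟨ht.le, not_le.2 ht⟩).2
  · rintro h f x y hy ⟨-, hlt⟩
    rw [not_le] at hlt ⊢
    have : J (f.map u) < u x := (h _).trans_lt (hy ▸ hlt)
    exact ⟨this.le, this⟩

theorem isPreference_of_niveloids {hX : Convex ℝ X} {u : X → ℝ} (hu : IsAffine hX u)
    (hsurj : Function.Surjective u) {ι : Type*} [Nonempty ι] {J : ι → SimpleFunc S ℝ → ℝ}
    (hJ : ∀ i, IsConcaveNiveloid (J i)) {R : Act S X → Act S X → Prop}
    (hR : ∀ f g, R f g ↔ ∀ i, J i (g.map u) ≤ J i (f.map u)) : IsPreference hX R where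
  refl f := (hR f f).2 fun _ => le_rfl
  trans f g h hfg hgh := (hR f h).2 fun i => ((hR g h).1 hgh i).trans ((hR f g).1 hfg i)
  monotone f g h := (hR f g).2 fun i => (hJ i).mono _ _ fun s => by
    simpa only [map_constAct, (hJ i).const, SimpleFunc.map_apply] using (hR _ _).1 (h s) i
  continuous_left f g h := by
    simp only [hR, map_mixAct hu, ofPred_forall]
    exact isClosed_iInter fun i => isClosed_le continuous_const
      (((hJ i).continuous_segment _ _).comp continuous_subtype_val)
  continuous_right f g h := by
    simp only [hR, map_mixAct hu, ofPred_forall]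
    exact isClosed_iInter fun i => isClosed_le
      (((hJ i).continuous_segment _ _).comp continuous_subtype_val) continuous_const
  nontrivial := by
    obtain ⟨x, hx⟩ := hsurj 1
    obtain ⟨y, hy⟩ := hsurj 0
    refine ⟨constAct S x, constAct S y, ?_⟩
    simp only [Strict, hR, map_constAct, (hJ _).const, hx, hy]
    norm_num

end Utility

/-! ### Projection along a compact set. -/

section Projection

variable {A B : Type*} [TopologicalSpace A] [TopologicalSpace B]

theorem isClosed_setOf_exists_mem_of_isCompact {K : Set B} (hK : IsCompact K) {C : Set (A × B)}
    (hC : IsClosed C) : IsClosed {a | ∃ b ∈ K, (a, b) ∈ C} := by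
  have : CompactSpace K := isCompact_iff_compactSpace.1 hK
  have h := isClosedMap_fst_of_compactSpace (X := A) (Y := K) _
    (hC.preimage (continuous_fst.prodMk (continuous_subtype_val.comp continuous_snd)))
  convert h using 1
  ext a
  constructor
  · rintro ⟨b, hb, h⟩
    exact ⟨(a, ⟨b, hb⟩), h, rfl⟩
  · rintro ⟨⟨a, b⟩, h, rfl⟩
    exact ⟨b, b.2, h⟩

end Projection

/-! ### Functionals defined by a variational divergence. -/

section Divergence

variable {S : Type*} [MeasurableSpace S] {c : FinProb S → SigmaProb S → ℝ≥0∞}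

theorem IsVariationalDivergence.self_eq_zero (hc : IsVariationalDivergence c) (q : SigmaProb S) :
    c q.1 q = 0 := (hc.statDistance.eq_zero_iff q.1 q (mem_univ q)).2 rfl

theorem IsVariationalDivergence.isPenalty (hc : IsVariationalDivergence c) (q : SigmaProb S) :
    IsPenalty fun p => c p q :=
  ⟨hc.statDistance.lsc q (mem_univ q), q.1, hc.self_eq_zero q⟩

theorem distTo_le {Q : Set (SigmaProb S)} {q : SigmaProb S} (hq : q ∈ Q) (p : FinProb S) :
    distTo c Q p ≤ c p q := iInf₂_le q hq

theorem IsVariationalDivergence.isPenalty_distTo (hc : IsVariationalDivergence c)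
    (Q : ModelSet S) : IsPenalty (distTo c Q.carrier) := by
  obtain ⟨q, hq⟩ := Q.nonempty
  exact ⟨(hc.restrict Q).lsc, q.1, le_antisymm ((distTo_le hq _).trans_eq (hc.self_eq_zero q))
    zero_le⟩

theorem IsVariationalDivergence.distTo_eq_zero_iff (hc : IsVariationalDivergence c)
    (Q : ModelSet S) (p : FinProb S) :
    distTo c Q.carrier p = 0 ↔ p ∈ Subtype.val '' Q.carrier := by
  constructor
  · intro h
    obtain ⟨q, hq, e⟩ := (hc.restrict Q).min_attained p
    exact ⟨q, hq, ((hc.statDistance.eq_zero_iff p q (mem_univ q)).1 (e.trans h)).symm⟩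
  · rintro ⟨q, hq, rfl⟩
    exact le_antisymm ((distTo_le hq _).trans_eq (hc.self_eq_zero q)) zero_le

theorem IsVariationalDivergence.penalized_distTo_le [Nonempty S] (hc : IsVariationalDivergence c)
    (Q : ModelSet S) {q : SigmaProb S} (hq : q ∈ Q.carrier) (φ : SimpleFunc S ℝ) :
    penalized (distTo c Q.carrier) φ ≤ penalized (fun p => c p q) φ := by
  obtain ⟨p, hp, e⟩ := (hc.isPenalty q).exists_penalized_eq φ
  rw [e]
  have hle := distTo_le (c := c) hq p
  exact ((hc.isPenalty_distTo Q).penalized_le φ (ne_top_of_le_ne_top hp hle)).trans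
    (by linarith [ENNReal.toReal_mono hp hle])

/-- The minima over `p` and `q` are exchanged by taking the `q` that attains `c_Q` at a minimizing
`p`. -/
theorem IsVariationalDivergence.exists_penalized_distTo [Nonempty S]
    (hc : IsVariationalDivergence c) (Q : ModelSet S) (φ : SimpleFunc S ℝ) :
    ∃ q ∈ Q.carrier, penalized (distTo c Q.carrier) φ = penalized (fun p => c p q) φ := by
  obtain ⟨p, hp, e⟩ := (hc.isPenalty_distTo Q).exists_penalized_eq φ
  obtain ⟨q, hq, e'⟩ := (hc.restrict Q).min_attained p
  refine ⟨q, hq, le_antisymm (hc.penalized_distTo_le Q hq φ) ?_⟩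
  rw [e, ← e']
  exact (hc.isPenalty q).penalized_le φ (by rw [e']; exact hp)

/-- A minimizer has finite divergence, hence is absolutely continuous and ignores `q`-null events.
-/
theorem IsVariationalDivergence.penalized_congr [Nonempty S] (hc : IsVariationalDivergence c)
    (q : SigmaProb S) (A : {A : Set S // MeasurableSet A}) (hA : q.1.prob A = 0)
    {φ ψ : SimpleFunc S ℝ} (h : ∀ s ∉ A.1, φ s = ψ s) :
    penalized (fun p => c p q) φ ≤ penalized (fun p => c p q) ψ := by
  obtain ⟨p, hp, e⟩ := (hc.isPenalty q).exists_penalized_eq ψ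
  have hpA := (hc.restrict (ModelSet.single q)).absCont p q rfl hp.lt_top A hA
  rw [e, ← p.integral_congr_of_prob_eq_zero A hpA h]
  exact (hc.isPenalty q).penalized_le φ hp

/-- The mixture of the minimizers for `q` and `q'` is a candidate for the mixed model. -/
theorem penalized_mix_le [Nonempty S] (hc : IsVariationalDivergence c) (hconv : JointlyConvex c)
    (q q' : SigmaProb S) (α : I) (φ : SimpleFunc S ℝ) :
    penalized (fun p => c p (SigmaProb.mix α q q')) φ ≤
      (α : ℝ) * penalized (fun p => c p q) φ + (1 - (α : ℝ)) * penalized (fun p => c p q') φ := by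
  obtain ⟨p, hp, e⟩ := (hc.isPenalty q).exists_penalized_eq φ
  obtain ⟨p', hp', e'⟩ := (hc.isPenalty q').exists_penalized_eq φ
  have h1 := ENNReal.mul_ne_top (ENNReal.ofReal_ne_top (r := (α : ℝ))) hp
  have h2 := ENNReal.mul_ne_top (ENNReal.ofReal_ne_top (r := 1 - (α : ℝ))) hp'
  have h3 := ENNReal.add_ne_top.2 ⟨h1, h2⟩
  have h := ENNReal.toReal_mono h3 (hconv p p' q q' α)
  rw [ENNReal.toReal_add h1 h2, ENNReal.toReal_mul, ENNReal.toReal_mul,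
    ENNReal.toReal_ofReal α.2.1, ENNReal.toReal_ofReal (sub_nonneg.2 α.2.2)] at h
  have h4 := (hc.isPenalty (SigmaProb.mix α q q')).penalized_le φ
    (ne_top_of_le_ne_top h3 (hconv p p' q q' α))
  rw [FinProb.integral_mix] at h4
  rw [e, e']
  linarith

/-- The set is the projection, along compact `Δ`, of a closed sublevel set of the joint objective.
-/
theorem isClosed_penalized_le [Nonempty S] (hc : IsVariationalDivergence c) (hl : JointlyLsc c)
    (φ : SimpleFunc S ℝ) (t : ℝ) : IsClosed {q | penalized (fun p => c p q) φ ≤ t} := by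
  obtain ⟨M, hM⟩ := SimpleFunc.exists_abs_le φ
  have hpos : ∀ p : FinProb S, 0 ≤ p.integral φ + M := fun p => by
    linarith [(abs_le.1 (p.abs_integral_le hM)).1]
  have hlsc : LowerSemicontinuous fun z : SigmaProb S × FinProb S =>
      ENNReal.ofReal (z.2.integral φ + M) + c z.2 z.1 := by
    refine LowerSemicontinuous.add (Continuous.lowerSemicontinuous ?_)
      (LowerSemicontinuous.comp hl continuous_swap)
    exact ENNReal.continuous_ofReal.comp
      (((FinProb.continuous_integral φ).comp continuous_snd).add continuous_const)
  -- Values are at least `-M`, so lower levels give the empty set; they are treated apart since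
  -- `ENNReal.ofReal` would truncate them.
  by_cases ht : 0 ≤ t + M
  · convert isClosed_setOf_exists_mem_of_isCompact (isCompact_univ (X := FinProb S))
      (hlsc.isClosed_preimage (ENNReal.ofReal (t + M))) using 1
    ext q
    simp only [mem_ofPred_eq, mem_univ, true_and, mem_preimage, mem_Iic]
    constructor
    · intro h
      obtain ⟨p, hp, e⟩ := (hc.isPenalty q).exists_penalized_eq φ
      refine ⟨p, ?_⟩
      rw [← ENNReal.ofReal_toReal hp, ← ENNReal.ofReal_add (hpos p) ENNReal.toReal_nonneg]
      exact ENNReal.ofReal_le_ofReal (by linarith)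
    · rintro ⟨p, h⟩
      have hp : c p q ≠ ∞ := ne_top_of_le_ne_top ENNReal.ofReal_ne_top (le_add_self.trans h)
      rw [← ENNReal.ofReal_toReal hp, ← ENNReal.ofReal_add (hpos p) ENNReal.toReal_nonneg,
        ENNReal.ofReal_le_ofReal_iff ht] at h
      linarith [(hc.isPenalty q).penalized_le φ hp]
  · convert isClosed_empty using 1
    ext q
    simp only [mem_ofPred_eq, mem_empty_iff_false, iff_false, not_le]
    obtain ⟨p, hp, e⟩ := (hc.isPenalty q).exists_penalized_eq φ
    rw [e]
    linarith [hpos p, ENNReal.toReal_nonneg (a := c p q)]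

end Divergence

end Misspec

namespace Misspec

/-! ### From a representation to the axioms; uniqueness of the divergence. -/

section Representation

variable {S : Type*} [MeasurableSpace S] [Nonempty S] {E : Type*} [AddCommGroup E] [Module ℝ E]
  {X : Set E} {hX : Convex ℝ X} {star pref : ModelSet S → Act S X → Act S X → Prop}
  {u : X → ℝ} {c : FinProb S → SigmaProb S → ℝ≥0∞}

namespace IsRepresentation

theorem star_iff_penalized (H : IsRepresentation hX star pref u c) (Q : ModelSet S)
    (f g : Act S X) : star Q f g ↔ ∀ q : Q.carrier,
      penalized (fun p => c p q) (g.map u) ≤ penalized (fun p => c p q) (f.map u) := by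
  rw [H.star_iff]
  simp only [fun q => (H.divergence.isPenalty q).value_eq u, EReal.coe_le_coe_iff,
    Subtype.forall]

theorem star_single_iff (H : IsRepresentation hX star pref u c) (q : SigmaProb S)
    (f g : Act S X) : star (ModelSet.single q) f g ↔
      penalized (fun p => c p q) (g.map u) ≤ penalized (fun p => c p q) (f.map u) := by
  rw [H.star_iff_penalized]
  exact ⟨fun h => h ⟨q, rfl⟩, by rintro h ⟨_, rfl⟩; exact h⟩

theorem pref_iff_penalized (H : IsRepresentation hX star pref u c) (Q : ModelSet S)
    (f g : Act S X) : pref Q f g ↔ penalized (distTo c Q.carrier) (g.map u) ≤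
      penalized (distTo c Q.carrier) (f.map u) := by
  rw [H.pref_iff, (H.divergence.isPenalty_distTo Q).value_eq,
    (H.divergence.isPenalty_distTo Q).value_eq, EReal.coe_le_coe_iff]

theorem star_const_iff (H : IsRepresentation hX star pref u c) (Q : ModelSet S) (x y : X) :
    star Q (constAct S x) (constAct S y) ↔ u y ≤ u x := by
  have : Nonempty Q.carrier := Q.nonempty.to_subtype
  simp [H.star_iff_penalized, fun q => (H.divergence.isPenalty q).penalized_const]

theorem pref_const_iff (H : IsRepresentation hX star pref u c) (Q : ModelSet S) (x y : X) :
    pref Q (constAct S x) (constAct S y) ↔ u y ≤ u x := by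
  rw [H.pref_iff_penalized, map_constAct, map_constAct,
    (H.divergence.isPenalty_distTo Q).penalized_const,
    (H.divergence.isPenalty_distTo Q).penalized_const]

theorem isCertEquiv_iff (H : IsRepresentation hX star pref u c) (f : Act S X) (q : SigmaProb S)
    (y : X) : IsCertEquiv star f q y ↔ u y = penalized (fun p => c p q) (f.map u) := by
  rw [IsCertEquiv, Indiff, H.star_single_iff, H.star_single_iff, map_constAct,
    (H.divergence.isPenalty q).penalized_const, le_antisymm_iff]

theorem isDominance (H : IsRepresentation hX star pref u c) (Q : ModelSet S) :
    IsDominance hX Q.carrier (star Q) where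
  preference :=
    have : Nonempty Q.carrier := Q.nonempty.to_subtype
    isPreference_of_niveloids H.affine H.onto
      (fun q : Q.carrier => (H.divergence.isPenalty q.1).concaveNiveloid)
      (H.star_iff_penalized Q)
  c_complete x y := by
    rw [H.star_const_iff, H.star_const_iff]
    exact le_total _ _
  complete := by
    rintro ⟨q, hq⟩ f g
    obtain rfl : Q = ModelSet.single q := by
      obtain ⟨C, _, _, _⟩ := Q
      obtain rfl : C = {q} := hq
      rfl
    rw [H.star_single_iff, H.star_single_iff]
    exact le_total _ _
  weak_c_independent f g x y α h0 h1 h := by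
    rw [H.star_iff_penalized] at h ⊢
    intro q
    -- Mixing with a constant act translates the functional, so that the constant cancels in
    -- comparisons.
    have key : ∀ (f : Act S X) (z : X), penalized (fun p => c p q) ((mixAct hX α f
        (constAct S z)).map u) = penalized (fun p => c p q) ((α : ℝ) • f.map u) +
        (1 - (α : ℝ)) * u z := by
      intro f z
      rw [← (H.divergence.isPenalty q.1).concaveNiveloid.add_const, map_mixAct H.affine,
        map_constAct]
      congr 1
    have hq := h q
    rw [key, key] at hq ⊢
    linarith
  convex f g h α h0 h1 hf hg := by
    rw [H.star_iff_penalized] at hf hg ⊢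
    intro q
    have hα := (H.divergence.isPenalty q.1).concaveNiveloid.concave (f.map u) (g.map u) α
      α.2.1 α.2.2
    rw [map_mixAct H.affine]
    nlinarith [mul_le_mul_of_nonneg_left (hf q) α.2.1,
      mul_le_mul_of_nonneg_left (hg q) (sub_nonneg.2 α.2.2)]

theorem isRational (H : IsRepresentation hX star pref u c) (Q : ModelSet S) :
    IsRational hX (pref Q) where
  preference := isPreference_of_niveloids (ι := Unit) H.affine H.onto
    (fun _ => (H.divergence.isPenalty_distTo Q).concaveNiveloid)
    (fun f g => by rw [H.pref_iff_penalized Q f g]; exact ⟨fun h _ => h, fun h => h ()⟩)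
  complete f g := by
    rw [H.pref_iff_penalized, H.pref_iff_penalized]
    exact le_total _ _
  risk_independent x y z α _ _ h := by
    simp only [Indiff, H.pref_const_iff, ← le_antisymm_iff, H.affine α] at h ⊢
    rw [h]

theorem objCoherent (H : IsRepresentation hX star pref u c) (Q : ModelSet S) :
    ObjCoherent Q.carrier (star Q) := by
  intro f g h
  have hne : ∀ q ∈ Q.carrier, q.1.prob ⟨(agree f g).1ᶜ, (agree f g).2.compl⟩ = 0 :=
    fun q hq => by rw [q.1.prob_compl, h q hq, sub_self]
  have hfg : ∀ s ∉ (agree f g).1ᶜ, f s = g s := fun s hs => not_not.1 hs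
  constructor
  · rw [H.star_iff_penalized]
    exact fun q => H.divergence.penalized_congr q.1 _ (hne q q.2)
      fun s hs => by simp [hfg s hs]
  · rw [H.star_iff_penalized]
    exact fun q => H.divergence.penalized_congr q.1 _ (hne q q.2)
      fun s hs => by simp [hfg s hs]

/-- The probabilities accepted by coherence are the zeros of the conjugate, which by biconjugation
is `c_Q`; these zeros form `Q`. -/
theorem subjCoherent (H : IsRepresentation hX star pref u c) (Q : ModelSet S) :
    SubjCoherent hX Q.carrier (star Q) (pref Q) := by
  intro p
  have hk := H.divergence.isPenalty_distTo Q
  rw [coherent_at_iff H.affine H.onto hk.concaveNiveloid (H.star_const_iff Q)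
    (H.pref_iff_penalized Q), ← conjugate_eq_zero_iff,
    hk.conjugate_penalized (H.divergence.restrict Q).convex, Q.closedHull_carrier,
    H.divergence.distTo_eq_zero_iff]

theorem isRobust (H : IsRepresentation hX star pref u c) : IsRobust hX star pref where
  monotone Q Q' hQ f g h := by
    rw [H.star_iff_penalized] at h ⊢
    exact fun q => h ⟨q, hQ q.2⟩
  separable Q f g h := by
    rw [H.star_iff_penalized]
    exact fun q => (H.star_single_iff q.1 f g).1 (h q q.2)
  lsc x f := by
    convert isClosed_penalized_le H.divergence H.lsc (f.map u) (u x) using 1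
    ext q
    simp only [mem_ofPred_eq, H.isCertEquiv_iff, H.star_const_iff]
    constructor
    · rintro ⟨y, e, h⟩
      exact e ▸ h
    · intro h
      obtain ⟨y, hy⟩ := H.onto (penalized (fun p => c p q) (f.map u))
      exact ⟨y, hy, hy ▸ h⟩
  dominance := H.isDominance
  unbounded Q x y _ := by
    obtain ⟨z, hz⟩ := H.onto (2 * u x - u y)
    obtain ⟨z', hz'⟩ := H.onto (2 * u y - u x)
    refine ⟨z, z', ?_⟩
    rw [H.star_const_iff, H.star_const_iff, H.affine, H.affine, hz, hz']
    simp only [oneHalf]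
    constructor <;> linarith
  rational := H.isRational
  objCoherent := H.objCoherent
  subjCoherent := H.subjCoherent
  caution Q x f h := by
    rw [H.star_iff_penalized] at h
    rw [H.pref_iff_penalized, map_constAct, (H.divergence.isPenalty_distTo Q).penalized_const]
    push Not at h
    obtain ⟨q, hq⟩ := h
    rw [map_constAct, (H.divergence.isPenalty q.1).penalized_const] at hq
    exact (H.divergence.penalized_distTo_le Q q.2 _).trans hq.le
  consistency Q f g h := by
    rw [H.star_iff_penalized] at h
    rw [H.pref_iff_penalized]
    -- The model that is worst for `f` bounds the value of `g` as well.
    obtain ⟨q, hq, e⟩ := H.divergence.exists_penalized_distTo Q (f.map u)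
    rw [e]
    exact (H.divergence.penalized_distTo_le Q hq _).trans (h ⟨q, hq⟩)

theorem hybridizationAverse (H : IsRepresentation hX star pref u c) :
    HybridizationAverse hX star := by
  intro q q' α _ _ f y y' z hy hy' hz Q
  rw [H.isCertEquiv_iff] at hy hy' hz
  rw [H.star_const_iff, H.affine, hy, hy', hz]
  exact penalized_mix_le H.divergence H.convex q q' α _

/-- A representation determines its divergence. -/
theorem divergence_unique {c' : FinProb S → SigmaProb S → ℝ≥0∞}
    (H : IsRepresentation hX star pref u c) (H' : IsRepresentation hX star pref u c') :
    c' = c := by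
  -- Both functionals are the `u`-value of the same certainty equivalents; biconjugation then
  -- recovers the divergence.
  have e : ∀ q, penalized (fun p => c' p q) = penalized (fun p => c p q) := by
    intro q
    ext φ
    obtain ⟨f, rfl⟩ := exists_act_map_eq (S := S) H.onto φ
    obtain ⟨y, hy⟩ := H.onto (penalized (fun p => c p q) (f.map u))
    rw [← hy, (H'.isCertEquiv_iff f q y).1 ((H.isCertEquiv_iff f q y).2 hy)]
  funext p q
  have h1 := (H.divergence.isPenalty q).conjugate_penalized
    (H.divergence.statDistance.convex q (mem_univ q))
  have h2 := (H'.divergence.isPenalty q).conjugate_penalized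
    (H'.divergence.statDistance.convex q (mem_univ q))
  rw [e] at h2
  exact congrFun (h2.symm.trans h1) p

end IsRepresentation

end Representation

end Misspec

namespace Misspec

/-! ### From the axioms to functionals and a common utility. -/

section Axioms

variable {S : Type*} [MeasurableSpace S] {E : Type*} [AddCommGroup E] [Module ℝ E]
  {X : Set E} {hX : Convex ℝ X}

theorem IsDominance.isMixtureOrder {R : Act S X → Act S X → Prop} {Q : Set (SigmaProb S)}
    (hR : IsDominance hX Q R) :
    IsMixtureOrder hX fun x y => R (constAct S x) (constAct S y) where
  refl x := hR.preference.refl _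
  trans x y z := hR.preference.trans _ _ _
  total := hR.c_complete
  weak_indep x y z w α h0 h1 h := by
    simp only [← mixAct_const] at h ⊢
    exact hR.weak_c_independent _ _ _ _ α h0 h1 h
  convex x y z α h0 h1 h h' := by
    simp only [← mixAct_const]
    exact hR.convex _ _ _ α h0 h1 h h'
  closed_left x y z := by
    simpa only [mixAct_const] using
      hR.preference.continuous_left (constAct S x) (constAct S y) (constAct S z)
  closed_right x y z := by
    simpa only [mixAct_const] using
      hR.preference.continuous_right (constAct S x) (constAct S y) (constAct S z)

theorem IsRobust.star_single_of_mem {star pref : ModelSet S → Act S X → Act S X → Prop}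
    (hr : IsRobust hX star pref) {Q : ModelSet S} {q : SigmaProb S}
    (hq : q ∈ Q.carrier) {f g : Act S X} (h : star Q f g) : star (ModelSet.single q) f g :=
  hr.monotone Q _ (singleton_subset_iff.2 hq) f g h

theorem IsRobust.star_iff {star pref : ModelSet S → Act S X → Act S X → Prop}
    (hr : IsRobust hX star pref) (Q : ModelSet S) (f g : Act S X) :
    star Q f g ↔ ∀ q ∈ Q.carrier, star (ModelSet.single q) f g :=
  ⟨fun h _ hq => hr.star_single_of_mem hq h, hr.separable Q f g⟩

variable [Nonempty S]

theorem exists_forall_rel {Y : Type*} {r : Y → Y → Prop} (hrefl : ∀ x, r x x)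
    (htrans : ∀ x y z, r x y → r y z → r x z) (htot : ∀ x y, r x y ∨ r y x)
    (f : SimpleFunc S Y) : ∃ x, ∀ s, r x (f s) := by
  have key : ∀ F : Finset Y, F.Nonempty → ∃ x, ∀ y ∈ F, r x y := by
    intro F hF
    induction hF using Finset.Nonempty.cons_induction with
    | singleton a => exact ⟨a, by simpa using hrefl a⟩
    | cons a F ha hF ih =>
      obtain ⟨x, hx⟩ := ih
      rcases htot x a with h | h
      · exact ⟨x, by simpa using ⟨h, hx⟩⟩
      · exact ⟨a, by simpa using ⟨hrefl a, fun y hy => htrans _ _ _ h (hx y hy)⟩⟩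
  obtain ⟨x, hx⟩ := key f.range
    ⟨_, SimpleFunc.mem_range_self f (Classical.arbitrary S)⟩
  exact ⟨x, fun s => hx _ (SimpleFunc.mem_range_self f s)⟩

namespace IsPreference

variable {R : Act S X → Act S X → Prop}

theorem exists_best (hR : IsPreference hX R)
    (htot : ∀ x y, R (constAct S x) (constAct S y) ∨ R (constAct S y) (constAct S x))
    (f : Act S X) : ∃ x, R (constAct S x) f := by
  obtain ⟨x, hx⟩ := exists_forall_rel (r := fun x y => R (constAct S x) (constAct S y))
    (fun _ => hR.refl _) (fun _ _ _ => hR.trans _ _ _) htot f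
  exact ⟨x, hR.monotone _ _ hx⟩

theorem exists_worst (hR : IsPreference hX R)
    (htot : ∀ x y, R (constAct S x) (constAct S y) ∨ R (constAct S y) (constAct S x))
    (f : Act S X) : ∃ x, R f (constAct S x) := by
  obtain ⟨x, hx⟩ := exists_forall_rel (r := fun x y => R (constAct S y) (constAct S x))
    (fun _ => hR.refl _) (fun _ _ _ h h' => hR.trans _ _ _ h' h) (fun x y => htot y x) f
  exact ⟨x, hR.monotone _ _ hx⟩

theorem nontrivial_const (hR : IsPreference hX R)
    (htot : ∀ x y, R (constAct S x) (constAct S y) ∨ R (constAct S y) (constAct S x)) :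
    ∃ x y, R (constAct S x) (constAct S y) ∧ ¬ R (constAct S y) (constAct S x) := by
  obtain ⟨f, g, hfg, hn⟩ := hR.nontrivial
  obtain ⟨x, hx⟩ := hR.exists_best htot f
  obtain ⟨y, hy⟩ := hR.exists_worst htot g
  exact ⟨x, y, hR.trans _ _ _ hx (hR.trans _ _ _ hfg hy),
    fun h => hn (hR.trans _ _ _ hy (hR.trans _ _ _ h hx))⟩

theorem exists_certEquiv (hR : IsPreference hX R) (htot : ∀ f g, R f g ∨ R g f) (f : Act S X) :
    ∃ y, Indiff R f (constAct S y) := by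
  obtain ⟨x, hx⟩ := hR.exists_best (fun _ _ => htot _ _) f
  obtain ⟨y, hy⟩ := hR.exists_worst (fun _ _ => htot _ _) f
  have h := isPreconnected_closed_iff.1 (isPreconnected_univ (α := I)) _ _
    (hR.continuous_left (constAct S x) (constAct S y) f)
    (hR.continuous_right (constAct S x) (constAct S y) f) (fun α _ => htot _ _)
    ⟨1, mem_univ _, by
      have : mixX hX 1 x y = x := Subtype.ext (by rw [coe_mixX]; simp)
      simpa only [mem_ofPred_eq, mixAct_const, this] using hx⟩
    ⟨0, mem_univ _, by
      have : mixX hX 0 x y = y := Subtype.ext (by rw [coe_mixX]; simp)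
      simpa only [mem_ofPred_eq, mixAct_const, this] using hy⟩
  obtain ⟨α, -, h1, h2⟩ := h
  simp only [mem_ofPred_eq, mixAct_const] at h1 h2
  exact ⟨_, h2, h1⟩

/-- Complete preferences are represented by a functional of the utility profiles of acts. -/
theorem exists_functional (hR : IsPreference hX R) (htot : ∀ f g, R f g ∨ R g f) {u : X → ℝ}
    (hsurj : Function.Surjective u)
    (hu : ∀ x y, R (constAct S x) (constAct S y) ↔ u y ≤ u x) :
    ∃ J : SimpleFunc S ℝ → ℝ, (∀ f g, R f g ↔ J (g.map u) ≤ J (f.map u)) ∧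
      (∀ t, J (SimpleFunc.const S t) = t) ∧ ∀ φ ψ, (∀ s, φ s ≤ ψ s) → J φ ≤ J ψ := by
  -- `J φ` is the utility of a certainty equivalent of a chosen act with profile `φ`; by
  -- monotonicity the choice does not matter.
  choose act hact using exists_act_map_eq (S := S) hsurj
  choose ce hce using fun f => hR.exists_certEquiv htot f
  have hmono : ∀ f g : Act S X, (∀ s, g.map u s ≤ f.map u s) → R f g := fun f g h =>
    hR.monotone f g fun s => (hu _ _).2 (h s)
  have hrep : ∀ f g, R f g ↔ u (ce (act (g.map u))) ≤ u (ce (act (f.map u))) := by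
    intro f g
    have h1 : ∀ f : Act S X, R f (act (f.map u)) ∧ R (act (f.map u)) f := fun f =>
      ⟨hmono _ _ fun s => by rw [hact], hmono _ _ fun s => by rw [hact]⟩
    have h2 : ∀ f : Act S X, Indiff R f (constAct S (ce (act (f.map u)))) := fun f =>
      ⟨hR.trans _ _ _ (h1 f).1 (hce _).1, hR.trans _ _ _ (hce _).2 (h1 f).2⟩
    rw [← hu]
    exact ⟨fun h => hR.trans _ _ _ (h2 f).2 (hR.trans _ _ _ h (h2 g).1),
      fun h => hR.trans _ _ _ (h2 f).1 (hR.trans _ _ _ h (h2 g).2)⟩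
  refine ⟨fun φ => u (ce (act φ)), hrep, fun t => ?_, fun φ ψ h => ?_⟩
  · obtain ⟨x, rfl⟩ := hsurj t
    rw [← map_constAct]
    refine le_antisymm ((hu _ _).1 ?_) ((hu _ _).1 ?_)
    · refine hR.trans _ _ _ (hmono _ _ fun s => ?_) (hce _).1
      rw [hact]
    · refine hR.trans _ _ _ (hce _).2 (hmono _ _ fun s => ?_)
      rw [hact]
  · have := (hrep (act ψ) (act φ)).1 (hmono _ _ fun s => by rw [hact, hact]; exact h s)
    rwa [hact, hact] at this

end IsPreference

namespace IsDominance

variable {R : Act S X → Act S X → Prop} {Q : Set (SigmaProb S)}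

theorem exists_utility (hR : IsDominance hX Q R) (hunb : IsUnbounded hX R) :
    ∃ u : X → ℝ, IsAffine hX u ∧ Function.Surjective u ∧
      ∀ x y, R (constAct S x) (constAct S y) ↔ u y ≤ u x := by
  have hnt := hR.preference.nontrivial_const hR.c_complete
  obtain ⟨u, hu, hrep⟩ := hR.isMixtureOrder.exists_affine_utility hnt
  refine ⟨u, hu, affine_utility_surjective hu ?_ fun x y hxy => ?_, hrep⟩
  · obtain ⟨x, y, -, h⟩ := hnt
    exact ⟨x, y, not_le.1 fun h' => h ((hrep _ _).2 h')⟩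
  · obtain ⟨z, z', h, h'⟩ := hunb x y ⟨(hrep _ _).2 hxy.le, fun h => hxy.not_ge ((hrep _ _).1 h)⟩
    exact ⟨z, z', (hrep _ _).1 h, (hrep _ _).1 h'⟩

/-- Complete dominance relations are variational. -/
theorem exists_niveloid (hR : IsDominance hX Q R) (htot : ∀ f g, R f g ∨ R g f) {u : X → ℝ}
    (hu : IsAffine hX u) (hsurj : Function.Surjective u)
    (hrep : ∀ x y, R (constAct S x) (constAct S y) ↔ u y ≤ u x) :
    ∃ J : SimpleFunc S ℝ → ℝ, IsConcaveNiveloid J ∧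
      ∀ f g, R f g ↔ J (g.map u) ≤ J (f.map u) := by
  obtain ⟨J, hJ, hconst, hmono⟩ := hR.preference.exists_functional htot hsurj hrep
  have h0 : (0 : I) < oneHalf := by rw [← Subtype.coe_lt_coe]; norm_num [oneHalf]
  have h1 : oneHalf < (1 : I) := by rw [← Subtype.coe_lt_coe]; norm_num [oneHalf]
  have hadd : ∀ (φ : SimpleFunc S ℝ) (t : ℝ), J (φ + SimpleFunc.const S t) = J φ + t := by
    intro φ t
    -- Half mixtures with a constant of utility `0` have profiles `φ` and `J φ`, hence are
    -- indifferent; replacing that constant by one of utility `2 * t` shifts both by `t`.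
    obtain ⟨f, hf⟩ := exists_act_map_eq (S := S) hsurj ((2 : ℝ) • φ)
    obtain ⟨y, hy⟩ := hsurj (2 * J φ)
    obtain ⟨x, hx⟩ := hsurj 0
    obtain ⟨x', hx'⟩ := hsurj (2 * t)
    have e1 : (mixAct hX oneHalf f (constAct S x)).map u = φ := by
      rw [map_mixAct hu, hf, map_constAct, hx]
      ext s
      simp [oneHalf]
    have e2 : (mixAct hX oneHalf (constAct S y) (constAct S x)).map u =
        SimpleFunc.const S (J φ) := by
      rw [map_mixAct hu, map_constAct, map_constAct, hx, hy]
      ext s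
      simp [oneHalf]
    have e3 : (mixAct hX oneHalf f (constAct S x')).map u = φ + SimpleFunc.const S t := by
      rw [map_mixAct hu, hf, map_constAct, hx']
      ext s
      simp only [oneHalf, SimpleFunc.coe_add, Pi.add_apply, SimpleFunc.smul_apply, smul_eq_mul,
        SimpleFunc.const_apply]
      ring
    have e4 : (mixAct hX oneHalf (constAct S y) (constAct S x')).map u =
        SimpleFunc.const S (J φ + t) := by
      rw [map_mixAct hu, map_constAct, map_constAct, hx', hy]
      ext s
      simp only [oneHalf, SimpleFunc.coe_add, Pi.add_apply, SimpleFunc.smul_apply, smul_eq_mul,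
        SimpleFunc.const_apply]
      ring
    have h2 := hR.weak_c_independent f (constAct S y) x x' oneHalf h0 h1
      ((hJ _ _).2 (by rw [e1, e2, hconst]))
    have h3 := hR.weak_c_independent (constAct S y) f x x' oneHalf h0 h1
      ((hJ _ _).2 (by rw [e1, e2, hconst]))
    rw [hJ, e3, e4, hconst] at h2 h3
    exact le_antisymm h3 h2
  refine ⟨J, ⟨hmono, hadd, fun φ ψ a ha0 ha1 => ?_, hconst 0⟩, hJ⟩
  rcases ha0.eq_or_lt with rfl | ha0'
  · simp
  rcases ha1.eq_or_lt with rfl | ha1'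
  · simp
  obtain ⟨f, hf⟩ := exists_act_map_eq (S := S) hsurj φ
  -- The shift of `ψ` makes `f` and `g` both indifferent to `y`, so that the convexity axiom yields
  -- concavity.
  obtain ⟨g, hg⟩ := exists_act_map_eq (S := S) hsurj (ψ + SimpleFunc.const S (J φ - J ψ))
  obtain ⟨y, hy⟩ := hsurj (J φ)
  have h2 := hR.convex f g (constAct S y) ⟨a, ha0, ha1⟩ ha0' ha1'
    ((hJ _ _).2 (by rw [map_constAct, hconst, hf, hy]))
    ((hJ _ _).2 (by rw [map_constAct, hconst, hg, hy, hadd]; linarith))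
  rw [hJ, map_mixAct hu, map_constAct, hconst, hf, hg, hy] at h2
  have e : a • φ + (1 - a) • (ψ + SimpleFunc.const S (J φ - J ψ)) =
      a • φ + (1 - a) • ψ + SimpleFunc.const S ((1 - a) * (J φ - J ψ)) := by
    ext s
    simp only [SimpleFunc.coe_add, Pi.add_apply, SimpleFunc.smul_apply, smul_eq_mul,
      SimpleFunc.const_apply]
    ring
  simp only [e, hadd] at h2
  linarith

end IsDominance

namespace IsRobust

variable {star pref : ModelSet S → Act S X → Act S X → Prop}

/-- By monotonicity in `Q`, the singleton relation coarsens `≿*_Q` on consequences; a nontrivial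
coarsening is no coarser. -/
theorem star_single_const_iff_of_mem (hr : IsRobust hX star pref) {Q : ModelSet S}
    {q : SigmaProb S} (hq : q ∈ Q.carrier) (x y : X) :
    star (ModelSet.single q) (constAct S x) (constAct S y) ↔
      star Q (constAct S x) (constAct S y) := by
  obtain ⟨u, hu, hsurj, hrep⟩ := (hr.dominance Q).exists_utility (hr.unbounded Q)
  have hd := hr.dominance (ModelSet.single q)
  rw [hrep]
  refine utility_represents_coarsening hu hsurj hd.isMixtureOrder.trans
    (fun x y h => hr.star_single_of_mem hq ((hrep x y).2 h))
    (hd.preference.nontrivial_const hd.c_complete) (fun x y z h _ => ?_) x y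
  exact hd.isMixtureOrder.mixture_of_rel h (t := 1 / 2) (by norm_num) (by norm_num) rfl rfl

theorem star_const_iff (hr : IsRobust hX star pref) (Q Q' : ModelSet S) (x y : X) :
    star Q (constAct S x) (constAct S y) ↔ star Q' (constAct S x) (constAct S y) := by
  obtain ⟨q, hq⟩ := Q.nonempty
  obtain ⟨q', hq'⟩ := Q'.nonempty
  -- The segment is a compact convex set that contains both models and so links the two rankings.
  rw [← hr.star_single_const_iff_of_mem hq, ← hr.star_single_const_iff_of_mem hq',
    hr.star_single_const_iff_of_mem (ModelSet.left_mem_segment q q'),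
    hr.star_single_const_iff_of_mem (ModelSet.right_mem_segment q q')]

theorem pref_const_iff (hr : IsRobust hX star pref) {u : X → ℝ} (hu : IsAffine hX u)
    (hsurj : Function.Surjective u)
    (hrep : ∀ Q x y, star Q (constAct S x) (constAct S y) ↔ u y ≤ u x) (Q : ModelSet S) (x y : X) :
    pref Q (constAct S x) (constAct S y) ↔ u y ≤ u x := by
  have hp := hr.rational Q
  have h0 : (0 : I) < oneHalf := by rw [← Subtype.coe_lt_coe]; norm_num [oneHalf]
  have h1 : oneHalf < (1 : I) := by rw [← Subtype.coe_lt_coe]; norm_num [oneHalf]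
  exact utility_represents_coarsening (r := fun x y => pref Q (constAct S x) (constAct S y))
    hu hsurj (fun x y z => hp.preference.trans _ _ _)
    (fun x y h => hr.consistency Q _ _ ((hrep Q x y).2 h))
    (hp.preference.nontrivial_const fun _ _ => hp.complete _ _)
    (fun x y z h h' => (hp.risk_independent x y z oneHalf h0 h1 ⟨h, h'⟩).1) x y

end IsRobust

end Axioms

end Misspec

namespace Misspec

/-! ### Divergences from jointly convex, jointly lower semicontinuous functions. -/

section Construction

variable {S : Type*} [MeasurableSpace S]

/-- Partial minimization: since `Q` is convex, the mixture of the two minimizing models is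
admissible. -/
theorem convexFn_distTo {c : FinProb S → SigmaProb S → ℝ≥0∞} (hc : JointlyConvex c)
    (Q : ModelSet S) (hmin : ∀ p, ∃ q ∈ Q.carrier, c p q = distTo c Q.carrier p) :
    ConvexFn (distTo c Q.carrier) := by
  intro p p' α
  obtain ⟨q, hq, e⟩ := hmin p
  obtain ⟨q', hq', e'⟩ := hmin p'
  rw [← e, ← e']
  exact (distTo_le (Q.convex q hq q' hq' α) _).trans (hc p p' q q' α)

theorem isVariationalDivergence_of_jointly {c : FinProb S → SigmaProb S → ℝ≥0∞}
    (hl : JointlyLsc c) (hc : JointlyConvex c) (hzero : ∀ p q, c p q = 0 ↔ p = q.1)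
    (hac : ∀ p q, c p q < ∞ → p.AbsCont q.1) : IsVariationalDivergence c := by
  have hstat : IsStatDistance univ c :=
    { grounded := fun q _ => le_antisymm (iInf_le_of_le q.1 ((hzero q.1 q).2 rfl).le) zero_le
      lsc := fun q _ => LowerSemicontinuous.comp hl (continuous_id.prodMk continuous_const)
      convex := fun q _ p p' α => by
        have h := hc p p' q q α
        rwa [show SigmaProb.mix α q q = q from Subtype.ext (FinProb.mix_self α q.1)] at h
      eq_zero_iff := fun p q _ => hzero p q }
  refine ⟨hstat, fun Q => ?_⟩
  have hmin : ∀ p, ∃ q ∈ Q.carrier, c p q = distTo c Q.carrier p := by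
    intro p
    have hp : LowerSemicontinuous fun q => c p q :=
      LowerSemicontinuous.comp (f := fun z : FinProb S × SigmaProb S => c z.1 z.2) hl
        (continuous_const.prodMk continuous_id)
    obtain ⟨q, hq, h⟩ := (hp.lowerSemicontinuousOn Q.carrier).exists_isMinOn Q.nonempty Q.compact
    exact ⟨q, hq, le_antisymm (le_iInf₂ fun q' hq' => h hq') (distTo_le hq p)⟩
  refine ⟨⟨fun q _ => hstat.grounded q (mem_univ q), fun q _ => hstat.lsc q (mem_univ q),
    fun q _ => hstat.convex q (mem_univ q), fun p q _ => hzero p q⟩, hmin, ?_, ?_,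
    convexFn_distTo hc Q hmin, fun p q _ => hac p q⟩
  · obtain ⟨q, hq⟩ := Q.nonempty
    exact le_antisymm (iInf_le_of_le q.1 ((distTo_le hq q.1).trans ((hzero q.1 q).2 rfl).le))
      zero_le
  · rw [lowerSemicontinuous_iff_isClosed_preimage]
    intro t
    convert isClosed_setOf_exists_mem_of_isCompact Q.compact (hl.isClosed_preimage t) using 1
    ext p
    simp only [mem_preimage, mem_Iic, mem_ofPred_eq]
    constructor
    · intro h
      obtain ⟨q, hq, e⟩ := hmin p
      exact ⟨q, hq, e ▸ h⟩
    · rintro ⟨q, hq, h⟩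
      exact (distTo_le hq p).trans h

theorem jointlyLsc_conjugate {J : SigmaProb S → SimpleFunc S ℝ → ℝ}
    (h : ∀ φ t, IsClosed {q | J q φ ≤ t}) : JointlyLsc fun p q => conjugate (J q) p := by
  refine lowerSemicontinuous_iSup fun φ => ?_
  have h1 : LowerSemicontinuous fun q => J q φ :=
    lowerSemicontinuous_iff_isClosed_preimage.2 fun t => h φ t
  have h2 : LowerSemicontinuous fun z : FinProb S × SigmaProb S => J z.2 φ + -z.1.integral φ :=
    LowerSemicontinuous.add (LowerSemicontinuous.comp h1 continuous_snd)
      ((FinProb.continuous_integral φ).comp continuous_fst).neg.lowerSemicontinuous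
  exact ENNReal.continuous_ofReal.comp_lowerSemicontinuous h2
    fun _ _ hab => ENNReal.ofReal_le_ofReal hab

theorem jointlyConvex_conjugate {J : SigmaProb S → SimpleFunc S ℝ → ℝ}
    (h : ∀ q q' (α : I) φ, J (SigmaProb.mix α q q') φ ≤
      (α : ℝ) * J q φ + (1 - (α : ℝ)) * J q' φ) :
    JointlyConvex fun p q => conjugate (J q) p := by
  intro p p' q q' α
  refine iSup_le fun φ => ?_
  rw [FinProb.integral_mix]
  calc ENNReal.ofReal (J (SigmaProb.mix α q q') φ -
        ((α : ℝ) * p.integral φ + (1 - (α : ℝ)) * p'.integral φ))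
      ≤ ENNReal.ofReal ((α : ℝ) * (J q φ - p.integral φ) +
          (1 - (α : ℝ)) * (J q' φ - p'.integral φ)) :=
        ENNReal.ofReal_le_ofReal (by linarith [h q q' α φ])
    _ ≤ ENNReal.ofReal ((α : ℝ) * (J q φ - p.integral φ)) +
          ENNReal.ofReal ((1 - (α : ℝ)) * (J q' φ - p'.integral φ)) := ENNReal.ofReal_add_le
    _ ≤ _ := by
        rw [ENNReal.ofReal_mul α.2.1, ENNReal.ofReal_mul (sub_nonneg.2 α.2.2)]
        gcongr
        · exact le_iSup (fun φ => ENNReal.ofReal (J q φ - p.integral φ)) φ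
        · exact le_iSup (fun φ => ENNReal.ofReal (J q' φ - p'.integral φ)) φ

/-- If `p A > 0` for a `q`-null `A`, the losses `-t` on `A` have `J`-value `0` but mean `-t * p A`,
so the conjugate at `p` is unbounded. -/
theorem absCont_of_conjugate_lt_top {J : SimpleFunc S ℝ → ℝ} {p q : FinProb S}
    (h : ∀ A, q.prob A = 0 → ∀ t : ℝ, J (t • eventInd A) = 0) (hp : conjugate J p < ∞) :
    p.AbsCont q := by
  intro A hA
  by_contra hne
  have hpos : 0 < p.prob A := (p.prob_nonneg A).lt_of_ne (Ne.symm hne)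
  have hle : ∀ t : ℝ, 0 ≤ t → t * p.prob A ≤ (conjugate J p).toReal := by
    intro t ht
    rw [← ENNReal.ofReal_le_iff_le_toReal hp.ne]
    have := le_iSup (fun φ => ENNReal.ofReal (J φ - p.integral φ)) ((-t) • eventInd A)
    rwa [h A hA, p.integral_smul, p.integral_eventInd, zero_sub, neg_mul, neg_neg] at this
  have h1 := hle (((conjugate J p).toReal + 1) / p.prob A) (by positivity)
  rw [div_mul_cancel₀ _ hpos.ne'] at h1
  linarith

end Construction

/-! ### The representation theorem. -/

section Main

variable {S : Type*} [MeasurableSpace S] {E : Type*} [AddCommGroup E] [Module ℝ E]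
  {X : Set E} {hX : Convex ℝ X} {star pref : ModelSet S → Act S X → Act S X → Prop}
  {u : X → ℝ}

/-- In utility units, hybridization aversion is convexity of `q ↦ J q φ`; the axiom covers only
interior weights, so the endpoints are handled by hand. -/
theorem HybridizationAverse.niveloid_mix_le (hs : HybridizationAverse hX star) (hu : IsAffine hX u)
    (hsurj : Function.Surjective u)
    (hrep : ∀ Q x y, star Q (constAct S x) (constAct S y) ↔ u y ≤ u x)
    {J : SigmaProb S → SimpleFunc S ℝ → ℝ} (hJ : ∀ q, IsConcaveNiveloid (J q))
    (hstar : ∀ q f g, star (ModelSet.single q) f g ↔ J q (g.map u) ≤ J q (f.map u))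
    (q q' : SigmaProb S) (α : I) (φ : SimpleFunc S ℝ) :
    J (SigmaProb.mix α q q') φ ≤ (α : ℝ) * J q φ + (1 - (α : ℝ)) * J q' φ := by
  obtain ⟨f, rfl⟩ := exists_act_map_eq (S := S) hsurj φ
  rcases (unitInterval.nonneg' (t := α)).eq_or_lt with h0 | h0
  · subst h0
    have : SigmaProb.mix 0 q q' = q' :=
      Subtype.ext (FinProb.ext (funext fun A => by simp [SigmaProb.mix, FinProb.mix]))
    simp [this]
  rcases (unitInterval.le_one' (t := α)).eq_or_lt with h1 | h1
  · subst h1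
    have : SigmaProb.mix 1 q q' = q :=
      Subtype.ext (FinProb.ext (funext fun A => by simp [SigmaProb.mix, FinProb.mix]))
    simp [this]
  have hce : ∀ q y, u y = J q (f.map u) → IsCertEquiv star f q y := by
    intro q y hy
    rw [IsCertEquiv, Indiff, hstar, hstar, map_constAct, (hJ q).const, hy]
    exact ⟨le_rfl, le_rfl⟩
  obtain ⟨y, hy⟩ := hsurj (J q (f.map u))
  obtain ⟨y', hy'⟩ := hsurj (J q' (f.map u))
  obtain ⟨z, hz⟩ := hsurj (J (SigmaProb.mix α q q') (f.map u))
  have := (hrep _ _ _).1 (hs q q' α h0 h1 f y y' z (hce _ _ hy) (hce _ _ hy') (hce _ _ hz)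
    (ModelSet.single q))
  rwa [hu, hy, hy', hz] at this

namespace IsRobust

theorem isClosed_niveloid_le (hr : IsRobust hX star pref) (hsurj : Function.Surjective u)
    {J : SigmaProb S → SimpleFunc S ℝ → ℝ} (hJ : ∀ q, IsConcaveNiveloid (J q))
    (hstar : ∀ q f g, star (ModelSet.single q) f g ↔ J q (g.map u) ≤ J q (f.map u))
    (φ : SimpleFunc S ℝ) (t : ℝ) : IsClosed {q | J q φ ≤ t} := by
  obtain ⟨f, rfl⟩ := exists_act_map_eq (S := S) hsurj φ
  obtain ⟨x, rfl⟩ := hsurj t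
  convert hr.lsc x f using 1
  ext q
  simp only [mem_ofPred_eq, IsCertEquiv, Indiff, hstar, map_constAct, (hJ q).const,
    ← le_antisymm_iff]
  constructor
  · intro h
    obtain ⟨y, hy⟩ := hsurj (J q (f.map u))
    exact ⟨y, hy, hy ▸ h⟩
  · rintro ⟨y, e, h⟩
    exact e ▸ h

/-- An act that departs from a constant of utility `0` only on a null event is indifferent to it, by
objective coherence. -/
theorem niveloid_eventInd (hr : IsRobust hX star pref) (hsurj : Function.Surjective u)
    {J : SigmaProb S → SimpleFunc S ℝ → ℝ} (hJ : ∀ q, IsConcaveNiveloid (J q))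
    (hstar : ∀ q f g, star (ModelSet.single q) f g ↔ J q (g.map u) ≤ J q (f.map u))
    (q : SigmaProb S) (A : {A : Set S // MeasurableSet A}) (hA : q.1.prob A = 0) (t : ℝ) :
    J q (t • eventInd A) = 0 := by
  obtain ⟨x, hx⟩ := hsurj t
  obtain ⟨y, hy⟩ := hsurj 0
  let f : Act S X := SimpleFunc.piecewise A.1 A.2 (constAct S x) (constAct S y)
  have hf : f.map u = t • eventInd A := by
    ext s
    simp only [f, SimpleFunc.map_apply, SimpleFunc.coe_piecewise, SimpleFunc.coe_const,
      SimpleFunc.smul_apply, eventInd_apply]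
    by_cases hs : s ∈ A.1 <;> simp [hs, hx, hy]
  have hle : q.1.prob ⟨A.1ᶜ, A.2.compl⟩ ≤ q.1.prob (agree f (constAct S y)) := by
    rw [← q.1.integral_eventInd, ← q.1.integral_eventInd]
    refine q.1.integral_mono fun s => ?_
    rw [eventInd_apply, eventInd_apply]
    refine Set.indicator_le_indicator_of_subset (fun s hs => ?_) (fun _ => zero_le_one) s
    have hs' : s ∉ A.1 := hs
    change f s = constAct S y s
    simp [f, hs']
  have hone : ∀ B, q.1.prob B ≤ 1 := fun B => by
    linarith [q.1.prob_compl B, q.1.prob_nonneg ⟨B.1ᶜ, B.2.compl⟩]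
  rw [q.1.prob_compl, hA, sub_zero] at hle
  have h := hr.objCoherent (ModelSet.single q) f (constAct S y)
    (by rintro _ rfl; exact le_antisymm (hone _) hle)
  rw [Indiff, hstar, hstar, map_constAct, (hJ q).const, hf, hy] at h
  exact le_antisymm h.2 h.1

variable [Nonempty S]

/-- A constant above the minimum is not dominated by `f` under the worst model, so caution bounds
the certainty equivalent from above; the constant at the minimum is dominated under every model, so
consistency bounds it from below. -/
theorem pref_iff_of_min (hr : IsRobust hX star pref) (hu : IsAffine hX u)
    (hsurj : Function.Surjective u)
    (hrep : ∀ Q x y, star Q (constAct S x) (constAct S y) ↔ u y ≤ u x)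
    {J : SigmaProb S → SimpleFunc S ℝ → ℝ} (hJ : ∀ q, IsConcaveNiveloid (J q))
    (hstar : ∀ q f g, star (ModelSet.single q) f g ↔ J q (g.map u) ≤ J q (f.map u))
    (Q : ModelSet S) {m : SimpleFunc S ℝ → ℝ} (hm : ∀ q ∈ Q.carrier, ∀ φ, m φ ≤ J q φ)
    (hm' : ∀ φ, ∃ q ∈ Q.carrier, m φ = J q φ) (f g : Act S X) :
    pref Q f g ↔ m (g.map u) ≤ m (f.map u) := by
  have hp := hr.rational Q
  obtain ⟨K, hK, hconst, -⟩ := hp.preference.exists_functional hp.complete hsurj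
    (hr.pref_const_iff hu hsurj hrep Q)
  have key : ∀ f : Act S X, K (f.map u) = m (f.map u) := by
    intro f
    apply le_antisymm
    · refine le_of_forall_gt_imp_ge_of_dense fun t ht => ?_
      obtain ⟨x, rfl⟩ := hsurj t
      rw [← hconst (u x), ← map_constAct (S := S), ← hK]
      refine hr.caution Q x f fun h => ?_
      obtain ⟨q, hq, e⟩ := hm' (f.map u)
      have := (hstar q _ _).1 (hr.star_single_of_mem hq h)
      rw [map_constAct, (hJ q).const] at this
      linarith
    · obtain ⟨x, hx⟩ := hsurj (m (f.map u))
      rw [← hx, ← hconst (u x), ← map_constAct (S := S), ← hK]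
      refine hr.consistency Q _ _ (hr.separable Q _ _ fun q hq => ?_)
      rw [hstar, map_constAct, (hJ q).const, hx]
      exact hm q hq _
  rw [hK, key, key]

/-- For a singleton, `≿_q` too is represented by `J q`, so subjective coherence describes the zeros
of its conjugate. -/
theorem conjugate_eq_zero_iff_eq (hr : IsRobust hX star pref) (hu : IsAffine hX u)
    (hsurj : Function.Surjective u)
    (hrep : ∀ Q x y, star Q (constAct S x) (constAct S y) ↔ u y ≤ u x)
    {J : SigmaProb S → SimpleFunc S ℝ → ℝ} (hJ : ∀ q, IsConcaveNiveloid (J q))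
    (hstar : ∀ q f g, star (ModelSet.single q) f g ↔ J q (g.map u) ≤ J q (f.map u))
    (p : FinProb S) (q : SigmaProb S) : conjugate (J q) p = 0 ↔ p = q.1 := by
  rw [conjugate_eq_zero_iff, ← coherent_at_iff hu hsurj (hJ q) (hrep (ModelSet.single q))
    (hr.pref_iff_of_min hu hsurj hrep hJ hstar (ModelSet.single q)
      (by rintro _ rfl φ; exact le_rfl) fun φ => ⟨q, rfl, rfl⟩),
    hr.subjCoherent (ModelSet.single q) p, ModelSet.closedHull_carrier]
  simp [ModelSet.single]

/-- Every affine utility that represents a robust, model hybridization averse family on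
consequences is part of a representation. -/
theorem exists_representation (hr : IsRobust hX star pref) (hs : HybridizationAverse hX star)
    (hu : IsAffine hX u) (hsurj : Function.Surjective u)
    (hrep : ∀ Q x y, star Q (constAct S x) (constAct S y) ↔ u y ≤ u x) :
    ∃ c, IsRepresentation hX star pref u c := by
  have hex : ∀ q : SigmaProb S, ∃ J : SimpleFunc S ℝ → ℝ, IsConcaveNiveloid J ∧
      ∀ f g, star (ModelSet.single q) f g ↔ J (g.map u) ≤ J (f.map u) := fun q =>
    (hr.dominance (ModelSet.single q)).exists_niveloid
      ((hr.dominance (ModelSet.single q)).complete ⟨q, rfl⟩) hu hsurj (hrep _)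
  choose J hJ hstar using hex
  let c : FinProb S → SigmaProb S → ℝ≥0∞ := fun p q => conjugate (J q) p
  have hlsc : JointlyLsc c :=
    jointlyLsc_conjugate (hr.isClosed_niveloid_le hsurj hJ hstar)
  have hconv : JointlyConvex c :=
    jointlyConvex_conjugate (hs.niveloid_mix_le hu hsurj hrep hJ hstar)
  have hdiv : IsVariationalDivergence c := isVariationalDivergence_of_jointly hlsc hconv
    (hr.conjugate_eq_zero_iff_eq hu hsurj hrep hJ hstar)
    (fun p q h => absCont_of_conjugate_lt_top (hr.niveloid_eventInd hsurj hJ hstar q) h)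
  have hpen : ∀ q, penalized (fun p => c p q) = J q := fun q => (hJ q).penalized_conjugate
  refine ⟨c, hu, hsurj, hlsc, hconv, hdiv, fun q f => ?_, fun Q f => ?_, fun Q f g => ?_,
    fun Q f g => ?_⟩
  · obtain ⟨p, h, -⟩ := (hdiv.isPenalty q).exists_objective_eq u f
    exact ⟨p, h⟩
  · obtain ⟨p, h, -⟩ := (hdiv.isPenalty_distTo Q).exists_objective_eq u f
    exact ⟨p, h⟩
  · simp only [hr.star_iff Q, hstar, fun q => (hdiv.isPenalty q).value_eq u,
      EReal.coe_le_coe_iff, hpen]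
  · rw [(hdiv.isPenalty_distTo Q).value_eq, (hdiv.isPenalty_distTo Q).value_eq,
      EReal.coe_le_coe_iff]
    refine hr.pref_iff_of_min hu hsurj hrep hJ hstar Q (fun q hq φ => ?_) (fun φ => ?_) f g
    · rw [← hpen]
      exact hdiv.penalized_distTo_le Q hq φ
    · simp only [← hpen]
      exact hdiv.exists_penalized_distTo Q φ

theorem exists_utility (hr : IsRobust hX star pref) : ∃ u : X → ℝ, IsAffine hX u ∧
    Function.Surjective u ∧ ∀ Q x y, star Q (constAct S x) (constAct S y) ↔ u y ≤ u x := by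
  let Q₀ := ModelSet.single (Classical.arbitrary (SigmaProb S))
  obtain ⟨u, hu, hsurj, hrep⟩ := (hr.dominance Q₀).exists_utility (hr.unbounded Q₀)
  exact ⟨u, hu, hsurj, fun Q x y => (hr.star_const_iff Q Q₀ x y).trans (hrep x y)⟩

end IsRobust

theorem IsRepresentation.exists_iff_positive_affine [Nonempty S] {c : FinProb S → SigmaProb S → ℝ≥0∞}
    (H : IsRepresentation hX star pref u c) (v : X → ℝ) :
    (∃ c', IsRepresentation hX star pref v c') ↔ ∃ a b : ℝ, 0 < a ∧ ∀ x, v x = a * u x + b := by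
  constructor
  · rintro ⟨c', H'⟩
    let Q₀ := ModelSet.single (Classical.arbitrary (SigmaProb S))
    exact affine_utility_unique H.affine H'.affine H.onto
      fun x y => (H.star_const_iff Q₀ x y).symm.trans (H'.star_const_iff Q₀ x y)
  · rintro ⟨a, b, ha, hv⟩
    -- The representation gives back the axioms, from which a divergence is built anew for the
    -- utility `v`.
    refine H.isRobust.exists_representation H.hybridizationAverse (fun α x y => ?_) (fun t => ?_)
      fun Q x y => ?_
    · rw [hv, hv, hv, H.affine]
      ring
    · obtain ⟨x, hx⟩ := H.onto ((t - b) / a)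
      exact ⟨x, by rw [hv, hx, mul_div_cancel₀ _ ha.ne', sub_add_cancel]⟩
    · rw [H.star_const_iff, hv, hv, add_le_add_iff_right, mul_le_mul_iff_right₀ ha]

end Main

end Misspec

theorem mainTheorem3 {S : Type*} [MeasurableSpace S] [Nonempty S]
    {E : Type*} [AddCommGroup E] [Module ℝ E] {X : Set E} (hX : Convex ℝ X)
    (star pref : Misspec.ModelSet S → Misspec.Act S X → Misspec.Act S X → Prop) :
    ((Misspec.IsRobust hX star pref ∧ Misspec.HybridizationAverse hX star) ↔
      ∃ (u : X → ℝ) (c : Misspec.FinProb S → Misspec.SigmaProb S → ℝ≥0∞),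
        Misspec.IsRepresentation hX star pref u c) ∧
    (∀ (u : X → ℝ) (c : Misspec.FinProb S → Misspec.SigmaProb S → ℝ≥0∞),
      Misspec.IsRepresentation hX star pref u c →
      (∀ u' : X → ℝ,
        (∃ c' : Misspec.FinProb S → Misspec.SigmaProb S → ℝ≥0∞,
          Misspec.IsRepresentation hX star pref u' c') ↔
        ∃ a b : ℝ, 0 < a ∧ ∀ x, u' x = a * u x + b) ∧
      (∀ c' : Misspec.FinProb S → Misspec.SigmaProb S → ℝ≥0∞,
        Misspec.IsRepresentation hX star pref u c' → c' = c)) := by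
  refine ⟨⟨?_, ?_⟩, fun u c H => ⟨H.exists_iff_positive_affine, fun c' H' => ?_⟩⟩
  · rintro ⟨hr, hs⟩
    obtain ⟨u, hu, hsurj, hrep⟩ := hr.exists_utility
    obtain ⟨c, H⟩ := hr.exists_representation hs hu hsurj hrep
    exact ⟨u, c, H⟩
  · rintro ⟨u, c, H⟩
    exact ⟨H.isRobust, H.hybridizationAverse⟩
  · exact H.divergence_unique H'
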